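/- **Setting.** Let $n,m\ge 1$, $\rho>0$, let $b:\mathbb R^n\to\mathbb R^n$, $\sigma:\mathbb R^n\to\mathbb R^{n\times m}$, and let $\pi,G:\mathbb R^n\to\mathbb R$ be continuous. Assume that there are $L>0$, $p\ge 2$, $K>0$ such that for all $x,\bar x\in\mathbb R^n$ $$|\phi(x)|\le L(1+|x|),\quad |\phi(\bar x)-\phi(x)|\le L|\bar x-x|\quad(\phi=b,\sigma),\qquad |\phi(x)|\le K(1+|x|^p)\quad(\phi=\pi,G),$$ and $\rho>p\big(\tfrac32L+(2p-1)L^2\big)$, where $|\cdot|$ is the Euclidean norm (the Frobenius norm for matrices). Let $W$ be an $m$-dimensional Brownian motion on a complete probability space $(\Omega,\mathcal F,\mathbb P)$, let $\mathbb F^W$ be the right-continuous augmentation of the filtration generated by $W$, and for each $x\in\mathbb R^n$ let $X^x$ be the (continuous, $\mathbb F^W$-adapted) solution of $$dX^x_t=b(X^x_t)\,dt+\sigma(X^x_t)\,dW_t,\qquad X^x_0=x.$$ Let $\mathcal T$ be the set of $\mathbb F^W$-stopping times with values in $[0,\infty]$, and define the optimal stopping value $$V(x)=\sup_{\tau\in\mathcal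 T}\mathbb E\Big[\int_0^\tau e^{-\rho s}\pi(X^x_s)\,ds+e^{-\rho\tau}G(X^x_\tau)\Big],$$ where the last term is $0$ on $\{\tau=\infty\}$. Let $\mathcal A(1)$ be the set of $\mathbb F^W$-adapted, nondecreasing, càdlàg processes $\xi$ with values in $[0,1]$ and $\xi_{0-}=0$ (so the measure $d\xi$ on $[0,\infty)$ has mass $\xi_0$ at $0$). For $\lambda\in[0,1]$ define the entropy-regularized value $$V^\lambda(x)=\sup_{\xi\in\mathcal A(1)}\mathbb E\Big[\int_0^\infty e^{-\rho t}\pi(X^x_t)(1-\xi_t)\,dt+\int_{[0,\infty)}e^{-\rho t}G(X^x_t)\,d\xi_t-\lambda\int_0^\infty e^{-\rho t}(1-\xi_t)\log(1-\xi_t)\,dt\Big],$$ with $0\log 0=0$. **Proposition.** These problems are well posed: for every $x$ the pathwise integrals converge almost surely, the random payoffs in brackets are integrable, and the suprema are finite. For all $\lambda,\bar\lambda\in[0,1]$, $$\sup_{x\in\mathbb R^n}\big|V^\lambda(x)-V^{\bar\lambda}(x)\big|\le\frac{|\lambda-\bar\lambda|}{\rho e}.$$ In particular, $V^\lambda\to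 V$ uniformly on $\mathbb R^n$ as $\lambda\to0$ in $[0,1]$. -/

import Mathlib

open MeasureTheory ProbabilityTheory Filter Topology Set
open scoped NNReal ENNReal Matrix

noncomputable section

namespace EntropyOS

/-- The data of the stopping problem: discount factor, drift, diffusion coefficient, running profit
and terminal profit. -/
structure Data (n m : ℕ) where
  ρ : ℝ
  b : EuclideanSpace ℝ (Fin n) → EuclideanSpace ℝ (Fin n)
  σ : EuclideanSpace ℝ (Fin n) → Matrix (Fin n) (Fin m) ℝ
  π : EuclideanSpace ℝ (Fin n) → ℝ
  G : EuclideanSpace ℝ (Fin n) → ℝ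

/-- The Euclidean (Frobenius) norm of a matrix. -/
def frob {n m : ℕ} (A : Matrix (Fin n) (Fin m) ℝ) : ℝ := √(∑ i, ∑ j, A i j ^ 2)

/-- The standing requirements on the data (continuity of `b` and `σ` is part of the Lipschitz
conditions). -/
structure Data.Standing {n m : ℕ} (D : Data n m) : Prop where
  rho_pos : 0 < D.ρ
  continuous_π : Continuous D.π
  continuous_G : Continuous D.G
  bounds : ∃ L p K : ℝ, 0 < L ∧ 2 ≤ p ∧ 0 < K ∧
    (∀ x, ‖D.b x‖ ≤ L * (1 + ‖x‖)) ∧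
    (∀ x y, ‖D.b y - D.b x‖ ≤ L * ‖y - x‖) ∧
    (∀ x, frob (D.σ x) ≤ L * (1 + ‖x‖)) ∧
    (∀ x y, frob (D.σ y - D.σ x) ≤ L * ‖y - x‖) ∧
    (∀ x, |D.π x| ≤ K * (1 + ‖x‖ ^ p)) ∧
    (∀ x, |D.G x| ≤ K * (1 + ‖x‖ ^ p)) ∧
    p * (3 / 2 * L + (2 * p - 1) * L ^ 2) < D.ρ

section Probability

variable {Ω : Type*} {mΩ : MeasurableSpace Ω}

/-- `W` is an `m`-dimensional standard Brownian motion: its coordinates are independent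
one-dimensional Brownian motions. -/
structure IsBrownianMotion {m : ℕ} (W : Fin m → ℝ≥0 → Ω → ℝ) (P : Measure Ω) : Prop where
  measurable : ∀ j t, Measurable (W j t)
  brownian : ∀ j, IsBrownianReal (W j) P
  indep : iIndepFun (fun j ω (t : ℝ≥0) => W j t ω) P

/-- The filtration generated by `W` and the `P`-null sets. -/
def nullGenerated {m : ℕ} {W : Fin m → ℝ≥0 → Ω → ℝ} {P : Measure Ω} [P.IsComplete]
    (hW : IsBrownianMotion W P) : Filtration ℝ≥0 mΩ where
  seq t := (⨆ j : Fin m, ⨆ s : ℝ≥0, ⨆ _ : s ≤ t,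
      MeasurableSpace.comap (W j s) inferInstance) ⊔
    MeasurableSpace.generateFrom {N : Set Ω | P N = 0}
  mono' := by
    intro s t hst
    refine sup_le_sup_right ?_ _
    refine iSup_mono fun j => iSup_mono fun r => ?_
    exact iSup_le fun h => le_iSup_of_le (h.trans hst) le_rfl
  le' := by
    intro t
    refine sup_le ?_ (MeasurableSpace.generateFrom_le fun N hN => (inferInstance : P.IsComplete).out' N hN)
    exact iSup_le fun j => iSup_le fun s => iSup_le fun _ => (hW.measurable j s).comap_le

/-- The Brownian filtration `𝔽^W`: the right-continuous extension of the (augmented) filtration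
generated by `W`. -/
def brownianFiltration {m : ℕ} {W : Fin m → ℝ≥0 → Ω → ℝ} {P : Measure Ω} [P.IsComplete]
    (hW : IsBrownianMotion W P) : Filtration ℝ≥0 mΩ :=
  (nullGenerated hW).rightCont

/-- The non-anticipating Riemann sum of `∫₀ᵗ H dW` along the dyadic partition of mesh `2⁻ᴺ`:
`∑ₖ H(k 2⁻ᴺ) (W((k+1) 2⁻ᴺ ∧ t) - W(k 2⁻ᴺ ∧ t))`. -/
def itoSum {n m : ℕ} (H : ℝ≥0 → Ω → Matrix (Fin n) (Fin m) ℝ) (W : Fin m → ℝ≥0 → Ω → ℝ)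
    (N : ℕ) (t : ℝ≥0) (ω : Ω) : EuclideanSpace ℝ (Fin n) :=
  ∑ k ∈ Finset.range ⌈2 ^ N * t⌉₊,
    WithLp.toLp 2 (H ((k : ℝ≥0) / 2 ^ N) ω *ᵥ
      fun j => W j (min (((k : ℝ≥0) + 1) / 2 ^ N) t) ω - W j (min ((k : ℝ≥0) / 2 ^ N) t) ω)

/-- `I` is the Itô integral process `∫₀ H dW` of the continuous adapted integrand `H`: the
non-anticipating Riemann sums converge to it in probability, uniformly on compact time intervals.
(For continuous adapted `H` this limit always exists, and it determines `I` up to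
indistinguishability.) -/
def IsItoIntegral {n m : ℕ} (H : ℝ≥0 → Ω → Matrix (Fin n) (Fin m) ℝ) (W : Fin m → ℝ≥0 → Ω → ℝ)
    (P : Measure Ω) (I : ℝ≥0 → Ω → EuclideanSpace ℝ (Fin n)) : Prop :=
  ∀ T : ℝ≥0, ∀ ε : ℝ, 0 < ε →
    Tendsto (fun N : ℕ => P {ω | ∃ t ≤ T, ε ≤ ‖itoSum H W N t ω - I t ω‖}) atTop (𝓝 0)

/-- `X` is a (strong) solution of `dX = b(X) dt + σ(X) dW`, `X₀ = x`: a continuous adapted process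
with `X_t = x + ∫₀ᵗ b(X_s) ds + ∫₀ᵗ σ(X_s) dW_s` for all `t`, almost surely. -/
structure IsSolution {n m : ℕ} (D : Data n m) (𝔽 : Filtration ℝ≥0 mΩ)
    (W : Fin m → ℝ≥0 → Ω → ℝ) (P : Measure Ω) (x : EuclideanSpace ℝ (Fin n))
    (X : ℝ≥0 → Ω → EuclideanSpace ℝ (Fin n)) : Prop where
  adapted : ∀ t, Measurable[𝔽 t] (X t)
  continuous : ∀ᵐ ω ∂P, Continuous fun t => X t ω
  equation : ∃ I : ℝ≥0 → Ω → EuclideanSpace ℝ (Fin n),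
    IsItoIntegral (fun t ω => D.σ (X t ω)) W P I ∧
    ∀ᵐ ω ∂P, ∀ t : ℝ≥0,
      X t ω = x + (∫ s in (0 : ℝ)..t, D.b (X s.toNNReal ω)) + I t ω

/-- The singular controls `𝒜(1)`: adapted nondecreasing càdlàg processes with values in `[0,1]`
(the left limits exist by monotonicity). The convention `ξ_{0-} = 0` enters through
`SingularControl.stieltjes`. -/
structure SingularControl (𝔽 : Filtration ℝ≥0 mΩ) where
  toFun : ℝ≥0 → Ω → ℝ
  adapted : ∀ t, Measurable[𝔽 t] (toFun t)
  mem_Icc : ∀ t ω, toFun t ω ∈ Set.Icc (0 : ℝ) 1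
  mono : ∀ ω, Monotone fun t => toFun t ω
  rightCont : ∀ ω t, ContinuousWithinAt (fun s => toFun s ω) (Set.Ici t) t

/-- A path of a singular control, extended by `0` to negative times. -/
def SingularControl.stieltjes {𝔽 : Filtration ℝ≥0 mΩ} (ξ : SingularControl 𝔽) (ω : Ω) :
    StieltjesFunction ℝ where
  toFun t := if 0 ≤ t then ξ.toFun t.toNNReal ω else 0
  mono' := by
    intro s t hst
    dsimp only
    split_ifs with h1 h2 h2
    · exact ξ.mono ω (Real.toNNReal_le_toNNReal hst)
    · exact absurd (h1.trans hst) h2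
    · exact (ξ.mem_Icc _ _).1
    · exact le_rfl
  right_continuous' := by
    intro t
    by_cases ht : 0 ≤ t
    · have h : ContinuousWithinAt (fun s : ℝ => ξ.toFun s.toNNReal ω) (Set.Ici t) t :=
        (ξ.rightCont ω t.toNNReal).comp (f := Real.toNNReal)
          continuous_real_toNNReal.continuousWithinAt
          fun s hs => Real.toNNReal_le_toNNReal hs
      refine h.congr (fun s hs => ?_) ?_
      · simp [ht.trans hs]
      · simp [ht]
    · have h : (fun s : ℝ => if 0 ≤ s then ξ.toFun s.toNNReal ω else 0) =ᶠ[𝓝 t] fun _ => 0 := by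
        filter_upwards [Iio_mem_nhds (not_le.1 ht)] with s hs
        exact if_neg (not_le.2 (show s < 0 from hs))
      exact (continuousAt_const.congr h.symm).continuousWithinAt

/-- The random measure `dξ` on `[0,∞)` (carried by the real line, null on negative times); it has
mass `ξ₀` at time `0`, as `ξ_{0-} = 0`. -/
def SingularControl.dmeasure {𝔽 : Filtration ℝ≥0 mΩ} (ξ : SingularControl 𝔽) (ω : Ω) :
    Measure ℝ :=
  (ξ.stieltjes ω).measure

variable {n m : ℕ}

/-- The random payoff of a stopping time,
`∫₀^τ e^{-ρs} π(X_s) ds + e^{-ρτ} G(X_τ)`, where the last term is `0` on `{τ = ∞}`. -/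
def stopPayoff (D : Data n m) (X : ℝ≥0 → Ω → EuclideanSpace ℝ (Fin n)) (τ : Ω → WithTop ℝ≥0)
    (ω : Ω) : ℝ :=
  (∫ s in {s : ℝ | 0 ≤ s ∧ (s.toNNReal : WithTop ℝ≥0) ≤ τ ω},
      Real.exp (-D.ρ * s) * D.π (X s.toNNReal ω)) +
    match τ ω with
    | ⊤ => 0
    | (t : ℝ≥0) => Real.exp (-D.ρ * t) * D.G (X t ω)

/-- The profit functional `J(x;τ)` of the stopping problem, where `X` starts from `x`. -/
def stopJ (D : Data n m) (P : Measure Ω) (X : ℝ≥0 → Ω → EuclideanSpace ℝ (Fin n))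
    (τ : Ω → WithTop ℝ≥0) : ℝ :=
  ∫ ω, stopPayoff D X τ ω ∂P

/-- The value of the stopping problem: the supremum of `J(x;τ)` over all stopping times. -/
def stopValue (D : Data n m) (P : Measure Ω) (𝔽 : Filtration ℝ≥0 mΩ)
    (X : ℝ≥0 → Ω → EuclideanSpace ℝ (Fin n)) : ℝ :=
  ⨆ τ : {τ : Ω → WithTop ℝ≥0 // IsStoppingTime 𝔽 τ}, stopJ D P X τ.1

/-- The random payoff of a singular control,
`∫ e^{-ρt} π(X_t)(1-ξ_t) dt + ∫ e^{-ρt} G(X_t) dξ_t - lam ∫ e^{-ρt} (1-ξ_t) log(1-ξ_t) dt`, all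
integrals over `[0,∞)` and `0 log 0 = 0`. -/
def controlPayoff (D : Data n m) {𝔽 : Filtration ℝ≥0 mΩ}
    (X : ℝ≥0 → Ω → EuclideanSpace ℝ (Fin n)) (lam : ℝ) (ξ : SingularControl 𝔽) (ω : Ω) : ℝ :=
  (∫ t in Set.Ici (0 : ℝ),
      Real.exp (-D.ρ * t) * (D.π (X t.toNNReal ω) * (1 - ξ.toFun t.toNNReal ω))) +
    (∫ t in Set.Ici (0 : ℝ), Real.exp (-D.ρ * t) * D.G (X t.toNNReal ω) ∂(ξ.dmeasure ω)) -
    lam * ∫ t in Set.Ici (0 : ℝ), Real.exp (-D.ρ * t) *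
      ((1 - ξ.toFun t.toNNReal ω) * Real.log (1 - ξ.toFun t.toNNReal ω))

/-- The entropy-regularized profit functional. -/
def controlJ (D : Data n m) (P : Measure Ω) {𝔽 : Filtration ℝ≥0 mΩ}
    (X : ℝ≥0 → Ω → EuclideanSpace ℝ (Fin n)) (lam : ℝ) (ξ : SingularControl 𝔽) : ℝ :=
  ∫ ω, controlPayoff D X lam ξ ω ∂P

/-- The entropy-regularized value: the supremum over all singular controls. -/
def controlValue (D : Data n m) (P : Measure Ω) (𝔽 : Filtration ℝ≥0 mΩ)
    (X : ℝ≥0 → Ω → EuclideanSpace ℝ (Fin n)) (lam : ℝ) : ℝ :=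
  ⨆ ξ : SingularControl 𝔽, controlJ D P X lam ξ

/-- All integrals and suprema in the two families of problems are genuine: the pathwise integrals
converge almost surely, the payoffs are integrable, and the suprema are finite. -/
structure WellPosed (D : Data n m) (P : Measure Ω) (𝔽 : Filtration ℝ≥0 mΩ)
    (X : ℝ≥0 → Ω → EuclideanSpace ℝ (Fin n)) : Prop where
  running : ∀ᵐ ω ∂P,
    IntegrableOn (fun t : ℝ => Real.exp (-D.ρ * t) * D.π (X t.toNNReal ω)) (Set.Ici 0)
  terminal : ∀ ξ : SingularControl 𝔽, ∀ᵐ ω ∂P,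
    IntegrableOn (fun t : ℝ => Real.exp (-D.ρ * t) * D.G (X t.toNNReal ω)) (Set.Ici 0)
      (ξ.dmeasure ω)
  stopping : ∀ τ : Ω → WithTop ℝ≥0, IsStoppingTime 𝔽 τ → Integrable (stopPayoff D X τ) P
  control : ∀ lam ∈ Set.Icc (0 : ℝ) 1, ∀ ξ : SingularControl 𝔽,
    Integrable (controlPayoff D X lam ξ) P
  stopping_bdd : BddAbove (Set.range fun τ : {τ : Ω → WithTop ℝ≥0 // IsStoppingTime 𝔽 τ} =>
    stopJ D P X τ.1)
  control_bdd : ∀ lam ∈ Set.Icc (0 : ℝ) 1,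
    BddAbove (Set.range fun ξ : SingularControl 𝔽 => controlJ D P X lam ξ)

end Probability

end EntropyOS

end

/-! ### Independence of Brownian increments from the right-continuous augmented filtration. -/

namespace EntropyOS

variable {Ω : Type*} {mΩ : MeasurableSpace Ω}

/-! Dependence on `lam`. On `[0,1]` one has `|x log x| ≤ 1/e`, so the discounted entropy of every
control is at most `1/(ρe)` in absolute value. `controlJ` is affine in `lam`, with minus the
expected entropy as slope. The functionals thus share a Lipschitz constant in `lam`, which their
supremum inherits; it does not depend on the starting point (`controlValue_le`).

Entropy zero. Let `τ_u` be the first time at which a control `ξ` reaches the level `u`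
(`levelTime`). Then `1 - ξ_t` is the Lebesgue measure of the `u` in `(0,1]` with `t < τ_u`, and `dξ`
is the image of Lebesgue measure on the levels with `τ_u < ∞` (`dmeasure_eq_map`). By Fubini the
payoff of `ξ` is the average over `u` of the payoffs of the stopping times `τ_u`
(`controlPayoff_eq`), so its expectation is at most the stopping value. Conversely a stopping time
is a control with a single jump and no entropy. Hence the value at `lam = 0` is the stopping value
(`controlValue_zero`), and uniform convergence is the Lipschitz bound taken at `0`.

Integrability carries most of the work: an integrable `Z` and a rate `r < ρ` are needed with
`|π(X_t)|` and `|G(X_t)|` at most `Z e^{rt}` for all `t` (`IsSolution.exists_integrable_bound`). On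
dyadic grids, `X` is compared with sums whose drift and diffusion are frozen along `X`. A Taylor
expansion against Gaussian increments makes `e^{-κt}(1+|Y|²)^q` a supermartingale as long as the sum
`Y` stays close to `X` (`exists_mesh_lintegral_le`). A localized maximal inequality and the limit in
the mesh give a weak-type bound for `sup_t e^{-κt}(1+|X_t|²)^q` (`mul_measure_exists_gt_le`). Weak
type gives moments of every order `θ < 1`, and `θ = p/(2q)` with `q = ⌊p⌋` turns the power `q` into
`p/2` at a rate below `ρ`. -/

theorem iIndepFun_bool {β : Type*} [MeasurableSpace β] {P : Measure Ω} [IsProbabilityMeasure P]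
    {Y : Bool → Ω → β} (h : IndepFun (Y true) (Y false) P) : iIndepFun Y P := by
  rw [iIndepFun_iff_measure_inter_preimage_eq_mul]
  intro S B hB
  have key := h.measure_inter_preimage_eq_mul (B true) (B false)
  by_cases h1 : true ∈ S <;> by_cases h2 : false ∈ S
  · have : S = {true, false} := by ext b; cases b <;> simp [h1, h2]
    subst this
    simp only [Finset.mem_insert, Finset.mem_singleton, iInter_iInter_eq_or_left,
      iInter_iInter_eq_left, Finset.prod_pair (show true ≠ false by simp)]
    exact key (hB _ (by simp)) (hB _ (by simp))
  · have : S = {true} := by ext b; cases b <;> simp [h1, h2]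
    subst this; simp
  · have : S = {false} := by ext b; cases b <;> simp [h1, h2]
    subst this; simp
  · have : S = ∅ := by ext b; cases b <;> simp [h1, h2]
    subst this; simp

/-- Each set of the enlarged σ-algebra differs from a set of `m₁` by a null set, and probabilities
do not see the difference. -/
theorem indep_sup_null {P : Measure Ω} {m₁ m₂ : MeasurableSpace Ω} (h : Indep m₁ m₂ P) :
    Indep (m₁ ⊔ MeasurableSpace.generateFrom {N : Set Ω | P N = 0}) m₂ P := by
  rw [Indep_iff] at h ⊢
  intro A B hA hB
  have hle : m₁ ⊔ MeasurableSpace.generateFrom {N : Set Ω | P N = 0} ≤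
      eventuallyMeasurableSpace m₁ (ae P) := by
    refine sup_le (le_eventuallyMeasurableSpace) (MeasurableSpace.generateFrom_le ?_)
    intro N hN
    exact ⟨∅, @MeasurableSet.empty _ m₁, ae_eq_empty.2 hN⟩
  obtain ⟨A', hA', hAA'⟩ := hle A hA
  rw [measure_congr (hAA'.inter (ae_eq_refl B)), measure_congr hAA']
  exact h A' B hA' hB

variable {m : ℕ} {W : Fin m → ℝ≥0 → Ω → ℝ}

theorem IsBrownianMotion.measurable_increment {P : Measure Ω} (hW : IsBrownianMotion W P) (s t : ℝ≥0) :
    Measurable fun ω j => W j t ω - W j s ω :=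
  measurable_pi_lambda _ fun j => (hW.measurable j t).sub (hW.measurable j s)

variable {P : Measure Ω} [IsProbabilityMeasure P]

theorem IsBrownianMotion.map_increment (hW : IsBrownianMotion W P) (s h : ℝ≥0) :
    P.map (fun ω j => W j (s + h) ω - W j s ω) = Measure.pi fun _ => gaussianReal 0 h := by
  have ha : ∀ j, AEMeasurable (fun ω => W j (s + h) ω - W j s ω) P := fun j =>
    ((hW.measurable j _).sub (hW.measurable j _)).aemeasurable
  have hi : iIndepFun (fun j ω => W j (s + h) ω - W j s ω) P :=
    hW.indep.comp (fun j (f : ℝ≥0 → ℝ) => f (s + h) - f s) fun j => by fun_prop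
  rw [(iIndepFun_iff_map_fun_eq_pi_map ha).1 hi]
  congr 1
  ext1 j
  exact (((hW.brownian j).toIsPreBrownianReal.shift s).hasLaw_eval h).map_eq

/-- The coordinates are independent, and each has its past independent of its future; hence the
whole family of pasts and futures, indexed by `Fin m × Bool`, is independent and may be regrouped.
-/
theorem IsBrownianMotion.indep_past_future (hW : IsBrownianMotion W P) (s : ℝ≥0) :
    Indep (⨆ j : Fin m, ⨆ r : ℝ≥0, ⨆ _ : r ≤ s, MeasurableSpace.comap (W j r) inferInstance)
      (⨆ j : Fin m, MeasurableSpace.comap (fun ω (r : ℝ≥0) => W j (s + r) ω - W j s ω)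
        inferInstance) P := by
  -- `false` labels the path stopped at `s`, `true` the shifted increments.
  let Y : Fin m → Bool → Ω → ℝ≥0 → ℝ := fun j b ω r =>
    bif b then W j (s + r) ω - W j s ω else W j (min r s) ω
  have mY : ∀ j b, Measurable (Y j b) := by
    intro j b
    refine measurable_pi_lambda _ fun r => ?_
    cases b
    · exact hW.measurable _ _
    · exact (hW.measurable _ _).sub (hW.measurable _ _)
  have h1 : iIndepFun (fun j ω => (Y j · ω)) P := by
    refine hW.indep.comp (fun j (f : ℝ≥0 → ℝ) (b : Bool) (r : ℝ≥0) =>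
      bif b then f (s + r) - f s else f (min r s)) fun j => ?_
    refine measurable_pi_lambda _ fun b => measurable_pi_lambda _ fun r => ?_
    cases b <;> simp only [cond_true, cond_false] <;> fun_prop
  have h2 : ∀ j, iIndepFun (Y j) P := by
    intro j
    refine iIndepFun_bool ?_
    have := (hW.brownian j).toIsPreBrownianReal.indepFun_shift s
    exact this.comp (φ := id) (ψ := fun (f : Set.Iic s → ℝ) (r : ℝ≥0) =>
      f ⟨min r s, Set.mem_Iic.2 (min_le_right _ _)⟩) measurable_id
      (measurable_pi_lambda _ fun r => measurable_pi_apply _)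
  have h := iIndepFun_uncurry' mY h1 h2
  have key := indep_iSup_of_disjoint
    (m := fun p : Fin m × Bool => MeasurableSpace.comap (Y p.1 p.2) inferInstance) (S := {p : Fin m × Bool | p.2 = false})
    (T := {p : Fin m × Bool | p.2 = true}) (fun p => (mY p.1 p.2).comap_le) h
    (by rw [Set.disjoint_left]; rintro ⟨j, b⟩ h1 h2; simp_all)
  refine indep_of_indep_of_le_left (indep_of_indep_of_le_right key ?_) ?_
  · exact iSup_le fun j => le_iSup₂_of_le (j, true) rfl le_rfl
  · refine iSup_le fun j => iSup_le fun r => iSup_le fun hr =>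
      le_iSup₂_of_le (j, false) rfl ?_
    rintro _ ⟨B, hB, rfl⟩
    refine ⟨(fun f => f r) ⁻¹' B, measurable_pi_apply r hB, ?_⟩
    ext ω
    simp [Y, hr]

variable [P.IsComplete]

theorem nullGenerated_indep (hW : IsBrownianMotion W P) {s t : ℝ≥0} (hst : s ≤ t) :
    Indep (nullGenerated hW s)
      (MeasurableSpace.comap (fun ω j => W j t ω - W j s ω) inferInstance) P := by
  refine indep_of_indep_of_le_right (indep_sup_null (hW.indep_past_future s)) ?_
  refine Measurable.comap_le ?_
  refine @measurable_pi_lambda _ _ _ (_) _ _ fun j => ?_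
  have h : Measurable[MeasurableSpace.comap (fun ω (r : ℝ≥0) => W j (s + r) ω - W j s ω)
      inferInstance] fun ω => W j t ω - W j s ω := by
    have := (measurable_pi_apply (X := fun _ : ℝ≥0 => ℝ) (t - s)).comp
      (comap_measurable (fun ω (r : ℝ≥0) => W j (s + r) ω - W j s ω))
    convert this using 2
    simp [hst]
  exact h.mono (le_iSup (fun j => MeasurableSpace.comap
    (fun ω (r : ℝ≥0) => W j (s + r) ω - W j s ω) inferInstance) j) le_rfl

/-- An event at time `s+` belongs to the unextended filtration at every `u > s`, so it is
independent of `W_t - W_u`. Path continuity carries this to `u ↓ s`, tested on bounded continuous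
functions. -/
theorem brownianFiltration_indep (hW : IsBrownianMotion W P) {s t : ℝ≥0} (hst : s < t) :
    Indep (brownianFiltration hW s)
      (MeasurableSpace.comap (fun ω j => W j t ω - W j s ω) inferInstance) P := by
  rw [Indep_iff]
  intro A B hA hB
  have hA' : ∀ u, s < u → MeasurableSet[nullGenerated hW u] A := by
    intro u hu
    rw [brownianFiltration, Filtration.rightCont_eq] at hA
    exact (iInf₂_le u hu : ⨅ j > s, nullGenerated hW j ≤ _) A hA
  have hAm : MeasurableSet A := (brownianFiltration hW).le s A hA
  have hind : IndepFun (A.indicator (1 : Ω → ℝ)) (fun ω j => W j t ω - W j s ω) P := by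
    refine indicator_indepFun_of_bcf hAm.nullMeasurableSet
      (hW.measurable_increment s t).aemeasurable fun f => ?_
    obtain ⟨u, hu_anti, hu_mem, hu_lim⟩ := exists_seq_strictAnti_tendsto' hst
    have hcont : ∀ᵐ ω ∂P, Tendsto (fun k => f (fun j => W j t ω - W j (u k) ω)) atTop
        (𝓝 (f (fun j => W j t ω - W j s ω))) := by
      have : ∀ᵐ ω ∂P, ∀ j, Continuous (W j · ω) := ae_all_iff.2 fun j => (hW.brownian j).cont
      filter_upwards [this] with ω hω
      refine (f.continuous.tendsto _).comp (tendsto_pi_nhds.2 fun j => ?_)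
      exact tendsto_const_nhds.sub (((hω j).tendsto s).comp hu_lim)
    have hmeas : ∀ v, AEStronglyMeasurable (fun ω => f (fun j => W j t ω - W j v ω)) P :=
      fun v => (f.continuous.measurable.comp (hW.measurable_increment v t)).aestronglyMeasurable
    have e : ∀ k, ∫ ω in A, f (fun j => W j t ω - W j (u k) ω) ∂P =
        P.real A * ∫ ω, f (fun j => W j t ω - W j (u k) ω) ∂P := by
      intro k
      have hi := nullGenerated_indep hW (hu_mem k).2.le
      have hAi : MeasurableSet[nullGenerated hW (u k)] A := hA' _ (hu_mem k).1
      exact hi.setIntegral_eq_mul ((nullGenerated hW).le (u k))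
        (hW.measurable_increment _ _).aemeasurable hAi f.continuous.measurable.aestronglyMeasurable
    have l1 := tendsto_integral_of_dominated_convergence (μ := P.restrict A)
      (F := fun k ω => f (fun j => W j t ω - W j (u k) ω)) (fun _ => ‖f‖)
      (fun k => (hmeas _).restrict) (integrable_const _)
      (fun k => Eventually.of_forall fun ω => f.norm_coe_le_norm _) (ae_restrict_of_ae hcont)
    have l2 := tendsto_integral_of_dominated_convergence (μ := P)
      (F := fun k ω => f (fun j => W j t ω - W j (u k) ω)) (fun _ => ‖f‖)
      (fun k => hmeas _) (integrable_const _)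
      (fun k => Eventually.of_forall fun ω => f.norm_coe_le_norm _) hcont
    refine tendsto_nhds_unique l1 ?_
    simp_rw [e]
    exact l2.const_mul _
  exact (IndepSets_iff _ _ _).1 (IndepFun.singleton_indepSets_of_indicator hind) A B rfl hB

end EntropyOS

/-! ### Second-order expansion of powers, and Gaussian moments. -/

namespace EntropyOS

/-- Here `s` will be the square root of the mesh: a cubic remainder is then of smaller order than
the mesh. `C` depends on `q` alone, so the error is uniform in the state. -/
theorem one_add_pow_taylor (q : ℕ) : ∃ C : ℝ, 0 ≤ C ∧ ∀ s a b T : ℝ, 0 ≤ s → s ≤ 1 → |a| ≤ T →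
    |b| ≤ T → 1 ≤ T →
    |(1 + s * a + s ^ 2 * b) ^ q -
      (1 + s * (q * a) + s ^ 2 * (q * b + q * (q - 1) / 2 * a ^ 2))| ≤ C * s ^ 3 * T ^ (q + 3) := by
  induction q with
  | zero => exact ⟨0, le_rfl, fun s a b T _ _ _ _ _ => by simp⟩
  | succ q ih =>
    obtain ⟨C, hC, h⟩ := ih
    refine ⟨3 * C + (3 * q + 2 * q ^ 2), by positivity, fun s a b T hs hs1 ha hb hT => ?_⟩
    set c : ℝ := q * b + q * (q - 1) / 2 * a ^ 2 with hc
    have hT0 : 0 ≤ T := by linarith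
    have hk0 : (0 : ℝ) ≤ q * (q - 1) / 2 := by
      rcases Nat.eq_zero_or_pos q with h0 | h0
      · simp [h0]
      · have : (1 : ℝ) ≤ q := by exact_mod_cast h0
        have : (0 : ℝ) ≤ q - 1 := by linarith
        positivity
    have hq0 : (0 : ℝ) ≤ q := q.cast_nonneg
    have hTT : T ≤ T ^ 2 := by nlinarith
    have hcb : |c| ≤ (q + q ^ 2) * T ^ 2 := by
      have ha2 : |a ^ 2| ≤ T ^ 2 := by rw [abs_pow]; gcongr
      calc |c| ≤ |(q : ℝ) * b| + |q * (q - 1) / 2 * a ^ 2| := abs_add_le _ _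
        _ = q * |b| + q * (q - 1) / 2 * |a ^ 2| := by
            rw [abs_mul, abs_mul, abs_of_nonneg hq0, abs_of_nonneg hk0]
        _ ≤ q * T ^ 2 + q ^ 2 * T ^ 2 := by
            have : (q : ℝ) * (q - 1) / 2 ≤ q ^ 2 := by nlinarith
            gcongr
            exact hb.trans hTT
        _ = _ := by ring
    -- The old remainder is multiplied by the base, which is at most `3T`; the product of the two
    -- quadratic polynomials leaves only terms of order `s ^ 3`.
    have hsplit : (1 + s * a + s ^ 2 * b) ^ (q + 1) - (1 + s * (((q + 1 : ℕ) : ℝ) * a) +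
        s ^ 2 * (((q + 1 : ℕ) : ℝ) * b + ((q + 1 : ℕ) : ℝ) * (((q + 1 : ℕ) : ℝ) - 1) / 2 * a ^ 2)) =
        (1 + s * a + s ^ 2 * b) * ((1 + s * a + s ^ 2 * b) ^ q -
          (1 + s * (q * a) + s ^ 2 * c)) + s ^ 3 * (a * c + q * a * b + s * (b * c)) := by
      rw [hc]; push_cast; ring
    have hr : |1 + s * a + s ^ 2 * b| ≤ 3 * T := by
      have h1 : |s * a| ≤ T := by
        rw [abs_mul, abs_of_nonneg hs]; nlinarith [abs_nonneg a]
      have h2 : |s ^ 2 * b| ≤ T := by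
        rw [abs_mul, abs_of_nonneg (by positivity : 0 ≤ s ^ 2)]
        nlinarith [abs_nonneg b, pow_le_one₀ hs hs1 (n := 2)]
      calc _ ≤ |1 + s * a| + |s ^ 2 * b| := abs_add_le _ _
        _ ≤ |1| + |s * a| + |s ^ 2 * b| := by gcongr; exact abs_add_le _ _
        _ ≤ 3 * T := by rw [abs_one]; linarith
    have hm : |a * c + q * a * b + s * (b * c)| ≤ (3 * q + 2 * q ^ 2) * T ^ 3 := by
      have h1 : |a * c| ≤ T * ((q + q ^ 2) * T ^ 2) := by rw [abs_mul]; gcongr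
      have h2 : |q * a * b| ≤ q * T * T ^ 2 := by
        rw [abs_mul, abs_mul, abs_of_nonneg hq0]
        gcongr
        exact hb.trans hTT
      have h3 : |s * (b * c)| ≤ T * ((q + q ^ 2) * T ^ 2) := by
        rw [abs_mul, abs_mul, abs_of_nonneg hs]
        calc s * (|b| * |c|) ≤ 1 * (|b| * |c|) := by gcongr
          _ ≤ _ := by rw [one_mul]; gcongr
      calc _ ≤ |a * c + q * a * b| + |s * (b * c)| := abs_add_le _ _
        _ ≤ |a * c| + |q * a * b| + |s * (b * c)| := by gcongr; exact abs_add_le _ _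
        _ ≤ T * ((q + q ^ 2) * T ^ 2) + q * T * T ^ 2 + T * ((q + q ^ 2) * T ^ 2) := by gcongr
        _ = _ := by ring
    rw [hsplit]
    calc _ ≤ |1 + s * a + s ^ 2 * b| * |(1 + s * a + s ^ 2 * b) ^ q -
          (1 + s * (q * a) + s ^ 2 * c)| + s ^ 3 * |a * c + q * a * b + s * (b * c)| := by
          refine (abs_add_le _ _).trans ?_
          rw [abs_mul, abs_mul, abs_of_nonneg (by positivity : 0 ≤ s ^ 3)]
      _ ≤ 3 * T * (C * s ^ 3 * T ^ (q + 3)) + s ^ 3 * ((3 * q + 2 * q ^ 2) * T ^ (q + 1 + 3)) := by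
          gcongr
          · exact h s a b T hs hs1 ha hb hT
          · refine hm.trans ?_
            gcongr
            omega
      _ = _ := by ring

section Gaussian

variable {n m : ℕ}

theorem frob_sq (M : Matrix (Fin n) (Fin m) ℝ) : frob M ^ 2 = ∑ i, ∑ j, M i j ^ 2 :=
  Real.sq_sqrt (by positivity)

theorem frob_nonneg (M : Matrix (Fin n) (Fin m) ℝ) : 0 ≤ frob M := Real.sqrt_nonneg _

theorem norm_toLp_mulVec_sq (M : Matrix (Fin n) (Fin m) ℝ) (z : Fin m → ℝ) :
    ‖WithLp.toLp 2 (M *ᵥ z)‖ ^ 2 = ∑ i, (∑ j, M i j * z j) ^ 2 := by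
  simp [EuclideanSpace.norm_sq_eq, Matrix.mulVec, dotProduct]

theorem norm_toLp_mulVec_le (M : Matrix (Fin n) (Fin m) ℝ) (z : Fin m → ℝ) :
    ‖WithLp.toLp 2 (M *ᵥ z)‖ ≤ frob M * ∑ j, |z j| := by
  have h0 : 0 ≤ ∑ j, |z j| := by positivity
  refine abs_le_of_sq_le_sq' ?_ (mul_nonneg (frob_nonneg M) h0) |>.2
  rw [norm_toLp_mulVec_sq, mul_pow, frob_sq, Finset.sum_mul]
  refine Finset.sum_le_sum fun i _ => ?_
  refine (Finset.sum_mul_sq_le_sq_mul_sq _ _ _).trans ?_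
  gcongr
  calc ∑ j, z j ^ 2 = ∑ j, |z j| ^ 2 := by simp
    _ ≤ (∑ j, |z j|) ^ 2 := Finset.sum_sq_le_sq_sum_of_nonneg fun j _ => abs_nonneg _

noncomputable abbrev stdGauss (m : ℕ) : Measure (Fin m → ℝ) := Measure.pi fun _ => gaussianReal 0 1

theorem memLp_eval_stdGauss (j : Fin m) {p : ℝ≥0∞} (hp : p ≠ ∞) :
    MemLp (fun z : Fin m → ℝ => z j) p (stdGauss m) :=
  (memLp_id_gaussianReal' p hp).comp_measurePreserving
    (measurePreserving_eval (fun _ : Fin m => gaussianReal 0 1) j)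

theorem integral_eval_stdGauss (j : Fin m) : ∫ z, z j ∂(stdGauss m) = 0 := by
  exact (integral_comp_eval (μ := fun _ : Fin m => gaussianReal 0 1) (i := j)
    (f := fun x : ℝ => x) (by fun_prop)).trans integral_id_gaussianReal

theorem integrable_pow_stdGauss (k : ℕ) :
    Integrable (fun z : Fin m → ℝ => (1 + ∑ j, |z j|) ^ k) (stdGauss m) := by
  rcases Nat.eq_zero_or_pos k with rfl | hk
  · simp
  have h : MemLp (fun z : Fin m → ℝ => 1 + ∑ j, |z j|) k (stdGauss m) := by
    have hs : MemLp (fun z : Fin m → ℝ => ∑ j, |z j|) k (stdGauss m) := by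
      refine memLp_finsetSum (f := fun (j : Fin m) (z : Fin m → ℝ) => |z j|) _ fun j _ => ?_
      exact (memLp_eval_stdGauss j (ENNReal.natCast_ne_top k)).abs
    exact MemLp.add (f := fun _ => (1 : ℝ)) (memLp_const 1) hs
  refine (h.integrable_norm_pow hk.ne').congr (Eventually.of_forall fun z => ?_)
  have : 0 ≤ 1 + ∑ j, |z j| := by positivity
  simp only [Real.norm_eq_abs, abs_of_nonneg this]

theorem integral_sq_linear_stdGauss (c : Fin m → ℝ) :
    Integrable (fun z : Fin m → ℝ => (∑ j, c j * z j) ^ 2) (stdGauss m) ∧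
    ∫ z, (∑ j, c j * z j) ^ 2 ∂(stdGauss m) = ∑ j, c j ^ 2 := by
  have hm : ∀ j, MemLp (fun x : ℝ => c j * x) 2 (gaussianReal 0 1) := fun j =>
    (memLp_id_gaussianReal 2).const_mul (c j)
  have hml : MemLp (fun z : Fin m → ℝ => ∑ j, c j * z j) 2 (stdGauss m) :=
    memLp_finsetSum _ fun j _ => (memLp_eval_stdGauss j ENNReal.ofNat_ne_top).const_mul (c j)
  refine ⟨hml.integrable_sq, ?_⟩
  have h0 : ∫ z, ∑ j, c j * z j ∂(stdGauss m) = 0 := by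
    rw [integral_finsetSum _ fun j _ =>
      ((memLp_eval_stdGauss j ENNReal.one_ne_top).integrable le_rfl).const_mul (c j)]
    simp [integral_const_mul, integral_eval_stdGauss]
  have hv := variance_sum_pi (μ := fun _ : Fin m => gaussianReal 0 1)
    (X := fun j (x : ℝ) => c j * x) hm
  have e : (∑ j, fun z : Fin m → ℝ => c j * z j) = fun z : Fin m → ℝ => ∑ j, c j * z j := by
    ext z; simp
  rw [e, variance_of_integral_eq_zero hml.aestronglyMeasurable.aemeasurable h0] at hv
  rw [hv]
  refine Finset.sum_congr rfl fun j _ => ?_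
  rw [variance_const_mul, variance_fun_id_gaussianReal]
  simp

theorem integral_norm_sq_mulVec (M : Matrix (Fin n) (Fin m) ℝ) :
    Integrable (fun z : Fin m → ℝ => ‖WithLp.toLp 2 (M *ᵥ z)‖ ^ 2) (stdGauss m) ∧
    ∫ z, ‖WithLp.toLp 2 (M *ᵥ z)‖ ^ 2 ∂(stdGauss m) = frob M ^ 2 := by
  simp_rw [norm_toLp_mulVec_sq, frob_sq]
  have h := fun i => integral_sq_linear_stdGauss (M i)
  refine ⟨integrable_finsetSum _ fun i _ => (h i).1, ?_⟩
  rw [integral_finsetSum _ fun i _ => (h i).1]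
  exact Finset.sum_congr rfl fun i _ => (h i).2

theorem integral_inner_mulVec (y : EuclideanSpace ℝ (Fin n)) (M : Matrix (Fin n) (Fin m) ℝ) :
    Integrable (fun z : Fin m → ℝ => inner ℝ y (WithLp.toLp 2 (M *ᵥ z))) (stdGauss m) ∧
    ∫ z, inner ℝ y (WithLp.toLp 2 (M *ᵥ z)) ∂(stdGauss m) = 0 := by
  have e : ∀ z : Fin m → ℝ, inner ℝ y (WithLp.toLp 2 (M *ᵥ z)) =
      ∑ i, ∑ j, (y i * M i j) * z j := by
    intro z
    simp [PiLp.inner_apply, Matrix.mulVec, dotProduct, Finset.sum_mul]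
    exact Finset.sum_congr rfl fun i _ => Finset.sum_congr rfl fun j _ => by ring
  simp_rw [e]
  have hi : ∀ i j, Integrable (fun z : Fin m → ℝ => (y i * M i j) * z j) (stdGauss m) :=
    fun i j => ((memLp_eval_stdGauss j ENNReal.one_ne_top).integrable le_rfl).const_mul _
  refine ⟨integrable_finsetSum _ fun i _ => integrable_finsetSum _ fun j _ => hi i j, ?_⟩
  rw [integral_finsetSum _ fun i _ => integrable_finsetSum _ fun j _ => hi i j]
  refine Finset.sum_eq_zero fun i _ => ?_
  rw [integral_finsetSum _ fun j _ => hi i j]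
  exact Finset.sum_eq_zero fun j _ => by rw [integral_const_mul, integral_eval_stdGauss, mul_zero]

/-- Moves the dependence on the mesh from the measure into the factor `√h`, so that one fixed
Gaussian measure serves all meshes. -/
theorem map_sqrt_smul_stdGauss (h : ℝ≥0) :
    (stdGauss m).map (fun z j => √(h : ℝ) * z j) = Measure.pi fun _ => gaussianReal 0 h := by
  have e : (gaussianReal 0 1).map (fun x => √(h : ℝ) * x) = gaussianReal 0 h := by
    rw [gaussianReal_map_const_mul]
    congr 1
    · simp
    · ext; simp
  rw [stdGauss, Measure.pi_map_pi (hμ := fun i => by rw [e]; infer_instance)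
    (fun j => by fun_prop)]
  simp [e]

end Gaussian

end EntropyOS

/-! ### Growth of `(1+|y|²)^q` over one time step. -/

namespace EntropyOS

section OneStep

variable {n m : ℕ}

set_option maxHeartbeats 1000000 in
-- The new value of `1+|y|²` is `(1+|y|²)(1 + s a + s² b)`, with `a` and `b` bounded uniformly in
-- `y` because the coefficients grow linearly. The term of order `s` is linear in `z` and will
-- average to zero.
theorem one_step_pointwise (q : ℕ) (hq : 1 ≤ q) (c : ℝ) (hc : 0 ≤ c) : ∃ C : ℝ, 0 ≤ C ∧
    ∀ (s : ℝ) (y β : EuclideanSpace ℝ (Fin n)) (M : Matrix (Fin n) (Fin m) ℝ) (z : Fin m → ℝ),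
      0 ≤ s → s ≤ 1 → ‖β‖ ≤ c * √(1 + ‖y‖ ^ 2) → frob M ≤ c * √(1 + ‖y‖ ^ 2) →
      (1 + ‖y + s ^ 2 • β + s • WithLp.toLp 2 (M *ᵥ z)‖ ^ 2) ^ q ≤ (1 + ‖y‖ ^ 2) ^ q *
        (1 + s * (2 * q / (1 + ‖y‖ ^ 2) * inner ℝ y (WithLp.toLp 2 (M *ᵥ z))) +
          s ^ 2 * (q * (2 * inner ℝ y β) / (1 + ‖y‖ ^ 2) +
            (2 * q ^ 2 - q) / (1 + ‖y‖ ^ 2) * ‖WithLp.toLp 2 (M *ᵥ z)‖ ^ 2) +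
          s ^ 3 * (C * (1 + ∑ j, |z j|) ^ (2 * (q + 3)))) := by
  obtain ⟨C, hC, hT⟩ := one_add_pow_taylor q
  -- The power of `1 + 2c + 4c²` comes from the common bound `T` on `|a|` and `|b|`; `3qc²` absorbs
  -- the two terms of `‖sβ + v‖²` that contain `β`.
  refine ⟨C * (1 + 2 * c + 4 * c ^ 2) ^ (q + 3) + 3 * q * c ^ 2, by positivity, ?_⟩
  intro s y β M z hs hs1 hβ hM
  set v : EuclideanSpace ℝ (Fin n) := WithLp.toLp 2 (M *ᵥ z) with hv
  set S : ℝ := 1 + ‖y‖ ^ 2 with hS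
  set g : ℝ := √S with hg
  have hS1 : 1 ≤ S := by rw [hS]; nlinarith [sq_nonneg ‖y‖]
  have hS0 : 0 < S := by linarith
  have hgS : g ^ 2 = S := Real.sq_sqrt hS0.le
  have hg0 : 0 < g := Real.sqrt_pos.2 hS0
  set R : ℝ := 1 + ∑ j, |z j| with hR
  have hz0 : 0 ≤ ∑ j, |z j| := by positivity
  have hR1 : 1 ≤ R := by linarith
  have hyg : ‖y‖ ≤ g := Real.le_sqrt_of_sq_le (by rw [hS]; linarith)
  have hvg : ‖v‖ ≤ c * g * R := by
    refine (norm_toLp_mulVec_le M z).trans ?_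
    have : ∑ j, |z j| ≤ R := by linarith
    exact mul_le_mul hM this hz0 (by positivity)
  have hyv : |inner ℝ y v| ≤ c * S * R := by
    refine (abs_real_inner_le_norm y v).trans ?_
    calc ‖y‖ * ‖v‖ ≤ g * (c * g * R) := by gcongr
      _ = c * g ^ 2 * R := by ring
      _ = _ := by rw [hgS]
  have hyβ : |inner ℝ y β| ≤ c * S := by
    refine (abs_real_inner_le_norm y β).trans ?_
    calc ‖y‖ * ‖β‖ ≤ g * (c * g) := by gcongr
      _ = c * g ^ 2 := by ring
      _ = _ := by rw [hgS]
  have hβv : inner ℝ β v ≤ c ^ 2 * S * R := by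
    refine (real_inner_le_norm β v).trans ?_
    calc ‖β‖ * ‖v‖ ≤ (c * g) * (c * g * R) := by gcongr
      _ = c ^ 2 * g ^ 2 * R := by ring
      _ = _ := by rw [hgS]
  have hβ2 : ‖β‖ ^ 2 ≤ c ^ 2 * S := by
    calc ‖β‖ ^ 2 ≤ (c * g) ^ 2 := by gcongr
      _ = _ := by rw [mul_pow, hgS]
  set a : ℝ := 2 * inner ℝ y v / S with ha
  set b : ℝ := (2 * inner ℝ y β + ‖s • β + v‖ ^ 2) / S with hb
  have hexp : 1 + ‖y + s ^ 2 • β + s • v‖ ^ 2 = S * (1 + s * a + s ^ 2 * b) := by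
    have e : y + s ^ 2 • β + s • v = y + s • (s • β + v) := by
      rw [smul_add, smul_smul, ← pow_two, add_assoc]
    rw [e, norm_add_sq_real, norm_smul, inner_smul_right, inner_add_right, inner_smul_right,
      mul_pow, Real.norm_eq_abs, sq_abs, ha, hb]
    field_simp
    rw [hS]
    ring
  set T : ℝ := (1 + 2 * c + 4 * c ^ 2) * R ^ 2 with hTdef
  have hR2 : R ≤ R ^ 2 := by nlinarith
  have hc2 : 0 ≤ c ^ 2 := sq_nonneg c
  have hcR : c * R ≤ c * R ^ 2 := by gcongr
  have hcR2 : 0 ≤ c ^ 2 * R ^ 2 := by positivity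
  have hR21 : 1 ≤ R ^ 2 := by nlinarith
  have hc1R : c ≤ c * R ^ 2 := by nlinarith
  have haT : |a| ≤ T := by
    rw [ha, abs_div, abs_mul, abs_two, abs_of_pos hS0, div_le_iff₀ hS0]
    calc 2 * |inner ℝ y v| ≤ 2 * (c * S * R) := by gcongr
      _ = (2 * (c * R)) * S := by ring
      _ ≤ T * S := by
        refine mul_le_mul_of_nonneg_right ?_ hS0.le
        rw [hTdef]
        linarith
  have hbT : |b| ≤ T := by
    have h1 : ‖s • β + v‖ ≤ 2 * c * g * R := by
      calc ‖s • β + v‖ ≤ ‖s • β‖ + ‖v‖ := norm_add_le _ _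
        _ ≤ c * g * R + c * g * R := by
          refine add_le_add ?_ hvg
          rw [norm_smul, Real.norm_eq_abs, abs_of_nonneg hs]
          calc s * ‖β‖ ≤ 1 * (c * g) := mul_le_mul hs1 hβ (norm_nonneg _) zero_le_one
            _ = c * g * 1 := by ring
            _ ≤ c * g * R := mul_le_mul_of_nonneg_left hR1 (mul_nonneg hc hg0.le)
        _ = _ := by ring
    have h2 : ‖s • β + v‖ ^ 2 ≤ 4 * c ^ 2 * R ^ 2 * S := by
      calc ‖s • β + v‖ ^ 2 ≤ (2 * c * g * R) ^ 2 := by gcongr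
        _ = 4 * c ^ 2 * R ^ 2 * g ^ 2 := by ring
        _ = _ := by rw [hgS]
    rw [hb, abs_div, abs_of_pos hS0, div_le_iff₀ hS0]
    calc |2 * inner ℝ y β + ‖s • β + v‖ ^ 2| ≤ 2 * |inner ℝ y β| + ‖s • β + v‖ ^ 2 := by
          refine (abs_add_le _ _).trans ?_
          rw [abs_mul, abs_two, abs_of_nonneg (sq_nonneg ‖s • β + v‖)]
      _ ≤ 2 * (c * S) + 4 * c ^ 2 * R ^ 2 * S := by gcongr
      _ = (2 * c + 4 * c ^ 2 * R ^ 2) * S := by ring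
      _ ≤ T * S := by
        refine mul_le_mul_of_nonneg_right ?_ hS0.le
        rw [hTdef]
        linarith
  have hT1 : 1 ≤ T := by
    rw [hTdef]
    linarith
  have hmain := (abs_le.1 (hT s a b T hs hs1 haT hbT hT1)).2
  have hqr : (1 : ℝ) ≤ q := by exact_mod_cast hq
  have hb' : b ≤ 2 * inner ℝ y β / S + ‖v‖ ^ 2 / S + s * (3 * c ^ 2 * R ^ (2 * (q + 3))) := by
    have h1 : ‖s • β + v‖ ^ 2 = s ^ 2 * ‖β‖ ^ 2 + 2 * s * inner ℝ β v + ‖v‖ ^ 2 := by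
      rw [norm_add_sq_real, norm_smul, inner_smul_left, mul_pow, Real.norm_eq_abs, sq_abs]
      simp only [conj_trivial]
      ring
    have hRp : R ≤ R ^ (2 * (q + 3)) := le_self_pow₀ hR1 (by omega)
    have h2 : s ^ 2 * ‖β‖ ^ 2 + 2 * s * inner ℝ β v ≤ s * (3 * c ^ 2 * R ^ (2 * (q + 3))) * S := by
      calc s ^ 2 * ‖β‖ ^ 2 + 2 * s * inner ℝ β v
          ≤ s * (c ^ 2 * S * R) + 2 * s * (c ^ 2 * S * R) := by
            refine add_le_add ?_ (mul_le_mul_of_nonneg_left hβv (by positivity))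
            have k1 : s ^ 2 ≤ s := by rw [pow_two]; exact mul_le_of_le_one_left hs hs1
            have k2 : ‖β‖ ^ 2 ≤ c ^ 2 * S * R :=
              hβ2.trans (le_mul_of_one_le_right (mul_nonneg hc2 hS0.le) hR1)
            exact mul_le_mul k1 k2 (sq_nonneg _) hs
        _ = s * (3 * c ^ 2 * R) * S := by ring
        _ ≤ _ := by gcongr
    rw [hb, h1, ← add_div, div_le_iff₀ hS0, add_mul, div_mul_cancel₀ _ hS0.ne']
    linarith
  -- By Cauchy–Schwarz `a²` is at most `4‖v‖²/S`. Together with the `‖v‖²/S` inside `b`, the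
  -- coefficient is `q + 2q(q-1) = 2q² - q`.
  have ha' : a ^ 2 ≤ 4 * ‖v‖ ^ 2 / S := by
    have h1 : (inner ℝ y v) ^ 2 ≤ S * ‖v‖ ^ 2 := by
      rw [← sq_abs]
      calc |inner ℝ y v| ^ 2 ≤ (‖y‖ * ‖v‖) ^ 2 := by
            gcongr
            exact abs_real_inner_le_norm y v
        _ = ‖y‖ ^ 2 * ‖v‖ ^ 2 := by ring
        _ ≤ _ := by gcongr; linarith
    rw [ha, div_pow, div_le_div_iff₀ (by positivity) hS0]
    calc (2 * inner ℝ y v) ^ 2 * S = 4 * S * (inner ℝ y v) ^ 2 := by ring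
      _ ≤ 4 * S * (S * ‖v‖ ^ 2) := by gcongr
      _ = _ := by ring
  rw [hexp, mul_pow]
  refine mul_le_mul_of_nonneg_left ?_ (by positivity)
  have hk0 : (0 : ℝ) ≤ q * (q - 1) / 2 := by
    have : (0 : ℝ) ≤ q - 1 := by linarith
    positivity
  calc (1 + s * a + s ^ 2 * b) ^ q
      ≤ 1 + s * (q * a) + s ^ 2 * (q * b + q * (q - 1) / 2 * a ^ 2) +
        C * s ^ 3 * T ^ (q + 3) := by linarith
    _ ≤ 1 + s * (q * a) + s ^ 2 * (q * (2 * inner ℝ y β / S + ‖v‖ ^ 2 / S +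
          s * (3 * c ^ 2 * R ^ (2 * (q + 3)))) + q * (q - 1) / 2 * (4 * ‖v‖ ^ 2 / S)) +
        C * s ^ 3 * T ^ (q + 3) := by gcongr
    _ = _ := by
      have hTp : T ^ (q + 3) = (1 + 2 * c + 4 * c ^ 2) ^ (q + 3) * R ^ (2 * (q + 3)) := by
        rw [hTdef, mul_pow, ← pow_mul]
      rw [hTp, ha]
      generalize (1 + 2 * c + 4 * c ^ 2) ^ (q + 3) = K
      generalize R ^ (2 * (q + 3)) = R'
      field_simp
      ring

/-- After averaging, the growth over a step is `1 + h(q c₁ + (2q²-q) c₂) + O(h^{3/2})`. The strict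
gap to `κ` absorbs the error for small `h`, uniformly in the state, and `1 + κh ≤ e^{κh}`. -/
theorem exists_mesh_lintegral_le (q : ℕ) (hq : 1 ≤ q) {c c₁ c₂ κ : ℝ} (hc : 0 ≤ c)
    (hκ : q * c₁ + (2 * q ^ 2 - q) * c₂ < κ) :
    ∃ h₀ : ℝ, 0 < h₀ ∧ ∀ h : ℝ≥0, (h : ℝ) ≤ h₀ →
      ∀ (y β : EuclideanSpace ℝ (Fin n)) (M : Matrix (Fin n) (Fin m) ℝ),
      ‖β‖ ≤ c * √(1 + ‖y‖ ^ 2) → frob M ≤ c * √(1 + ‖y‖ ^ 2) →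
      2 * inner ℝ y β ≤ c₁ * (1 + ‖y‖ ^ 2) → frob M ^ 2 ≤ c₂ * (1 + ‖y‖ ^ 2) →
      ∫⁻ w, ENNReal.ofReal ((1 + ‖y + (h : ℝ) • β + WithLp.toLp 2 (M *ᵥ w)‖ ^ 2) ^ q)
        ∂(Measure.pi fun _ => gaussianReal 0 h) ≤
        ENNReal.ofReal ((1 + ‖y‖ ^ 2) ^ q * Real.exp (κ * h)) := by
  obtain ⟨C, hC, hp⟩ := one_step_pointwise (n := n) (m := m) q hq c hc
  set μ : ℝ := ∫ z, (1 + ∑ j, |z j|) ^ (2 * (q + 3)) ∂(stdGauss m) with hμ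
  have hμ0 : 0 ≤ μ := integral_nonneg fun z => by positivity
  set d : ℝ := κ - (q * c₁ + (2 * q ^ 2 - q) * c₂) with hd
  have hd0 : 0 < d := by linarith
  -- Chosen so that `s ≤ s₀` gives both `s ≤ 1`, needed for the expansion, and `s C μ ≤ d`.
  set s₀ : ℝ := min 1 (d / (C * μ + 1)) with hs₀
  have hs₀0 : 0 < s₀ := by positivity
  refine ⟨s₀ ^ 2, by positivity, fun h hh y β M hβ hM h1 h2 => ?_⟩
  set s : ℝ := √(h : ℝ) with hs
  have hs0 : 0 ≤ s := Real.sqrt_nonneg _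
  have hs2 : s ^ 2 = h := Real.sq_sqrt h.coe_nonneg
  have hss₀ : s ≤ s₀ := by
    rw [hs]; exact (Real.sqrt_le_left hs₀0.le).2 hh
  have hs1 : s ≤ 1 := hss₀.trans (min_le_left _ _)
  have hsd : s * (C * μ) ≤ d := by
    have : s ≤ d / (C * μ + 1) := hss₀.trans (min_le_right _ _)
    rw [le_div_iff₀ (by positivity)] at this
    nlinarith
  set S : ℝ := 1 + ‖y‖ ^ 2 with hS
  have hS0 : 0 < S := by positivity
  have hqr : (1 : ℝ) ≤ q := by exact_mod_cast hq
  rw [← map_sqrt_smul_stdGauss, lintegral_map]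
  rotate_left
  · refine Measurable.ennreal_ofReal ?_
    have : Continuous fun w : Fin m → ℝ =>
        (1 + ‖y + (h : ℝ) • β + WithLp.toLp 2 (M *ᵥ w)‖ ^ 2) ^ q := by
      have : Continuous fun w : Fin m → ℝ => WithLp.toLp 2 (M *ᵥ w) :=
        (PiLp.continuous_toLp 2 _).comp (Continuous.matrix_mulVec continuous_const continuous_id)
      fun_prop
    exact this.measurable
  · fun_prop
  set F : (Fin m → ℝ) → ℝ := fun z => S ^ q *
        (1 + s * (2 * q / S * inner ℝ y (WithLp.toLp 2 (M *ᵥ z))) +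
          s ^ 2 * (q * (2 * inner ℝ y β) / S +
            (2 * q ^ 2 - q) / S * ‖WithLp.toLp 2 (M *ᵥ z)‖ ^ 2) +
          s ^ 3 * (C * (1 + ∑ j, |z j|) ^ (2 * (q + 3)))) with hF
  have hle : ∀ z : Fin m → ℝ, (1 + ‖y + (h : ℝ) • β +
      WithLp.toLp 2 (M *ᵥ fun j => s * z j)‖ ^ 2) ^ q ≤ F z := by
    intro z
    have e : WithLp.toLp 2 (M *ᵥ fun j => s * z j) = s • WithLp.toLp 2 (M *ᵥ z) := by
      rw [← WithLp.toLp_smul, ← Matrix.mulVec_smul]; rfl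
    rw [e, ← hs2]
    exact hp s y β M z hs0 hs1 hβ hM
  have i1 := integral_inner_mulVec y M
  have i2 := integral_norm_sq_mulVec M
  have i3 := integrable_pow_stdGauss (m := m) (2 * (q + 3))
  have j1 : Integrable (fun z : Fin m → ℝ =>
      s * (2 * q / S * inner ℝ y (WithLp.toLp 2 (M *ᵥ z)))) (stdGauss m) :=
    (i1.1.const_mul _).const_mul _
  have j2 : Integrable (fun z : Fin m → ℝ => (2 * q ^ 2 - q) / S *
      ‖WithLp.toLp 2 (M *ᵥ z)‖ ^ 2) (stdGauss m) := i2.1.const_mul _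
  have j2' : Integrable (fun z : Fin m → ℝ => s ^ 2 * (q * (2 * inner ℝ y β) / S +
      (2 * q ^ 2 - q) / S * ‖WithLp.toLp 2 (M *ᵥ z)‖ ^ 2)) (stdGauss m) :=
    ((integrable_const _).add j2).const_mul _
  have j3 : Integrable (fun z : Fin m → ℝ => s ^ 3 * (C * (1 + ∑ j, |z j|) ^ (2 * (q + 3))))
      (stdGauss m) := (i3.const_mul _).const_mul _
  have j01 : Integrable (fun z : Fin m → ℝ =>
      1 + s * (2 * q / S * inner ℝ y (WithLp.toLp 2 (M *ᵥ z)))) (stdGauss m) :=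
    (integrable_const _).add j1
  have j012 : Integrable (fun z : Fin m → ℝ =>
      1 + s * (2 * q / S * inner ℝ y (WithLp.toLp 2 (M *ᵥ z))) +
      s ^ 2 * (q * (2 * inner ℝ y β) / S +
      (2 * q ^ 2 - q) / S * ‖WithLp.toLp 2 (M *ᵥ z)‖ ^ 2)) (stdGauss m) := j01.add j2'
  have hFi : Integrable F (stdGauss m) := (j012.add j3).const_mul _
  have hFint : ∫ z, F z ∂(stdGauss m) = S ^ q * (1 + s ^ 2 * (q * (2 * inner ℝ y β) / S +
      (2 * q ^ 2 - q) / S * frob M ^ 2) + s ^ 3 * (C * μ)) := by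
    simp only [hF]
    rw [integral_const_mul, integral_add j012 j3, integral_add j01 j2',
      integral_add (integrable_const _) j1, integral_const_mul, integral_const_mul, i1.2,
      integral_const_mul, integral_add (integrable_const _) j2, integral_const_mul, i2.2,
      integral_const_mul, integral_const_mul]
    simp [hμ]
  calc ∫⁻ z, ENNReal.ofReal ((1 + ‖y + (h : ℝ) • β +
        WithLp.toLp 2 (M *ᵥ fun j => s * z j)‖ ^ 2) ^ q) ∂(stdGauss m)
      ≤ ∫⁻ z, ENNReal.ofReal (F z) ∂(stdGauss m) :=
        lintegral_mono fun z => ENNReal.ofReal_le_ofReal (hle z)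
    _ = ENNReal.ofReal (∫ z, F z ∂(stdGauss m)) :=
        (ofReal_integral_eq_lintegral_ofReal hFi (Eventually.of_forall fun z =>
          le_trans (by positivity) (hle z))).symm
    _ ≤ _ := by
      refine ENNReal.ofReal_le_ofReal ?_
      rw [hFint]
      refine mul_le_mul_of_nonneg_left ?_ (by positivity)
      have k1 : q * (2 * inner ℝ y β) / S ≤ q * c₁ := by
        rw [div_le_iff₀ hS0, mul_assoc]
        gcongr
      have hqq : (0 : ℝ) ≤ 2 * q ^ 2 - q := by nlinarith
      have k2 : (2 * q ^ 2 - q) / S * frob M ^ 2 ≤ (2 * q ^ 2 - q) * c₂ := by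
        rw [div_mul_eq_mul_div, div_le_iff₀ hS0, mul_assoc]
        gcongr
      calc _ = 1 + s ^ 2 * (q * (2 * inner ℝ y β) / S + (2 * q ^ 2 - q) / S * frob M ^ 2 +
            s * (C * μ)) := by ring
        _ ≤ 1 + s ^ 2 * (q * c₁ + (2 * q ^ 2 - q) * c₂ + d) := by gcongr
        _ = κ * h + 1 := by rw [hs2, hd]; ring
        _ ≤ _ := Real.add_one_le_exp _

end OneStep

end EntropyOS

/-! ### A localized maximal inequality, and the grid sums. -/

namespace EntropyOS

section Discrete

variable {Ω : Type*} {mΩ : MeasurableSpace Ω} {P : Measure Ω}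

/-- The freezing lemma: the independent argument is integrated first, with the other held fixed. -/
theorem IndepFun.lintegral_comp_prod {α β : Type*} {mα : MeasurableSpace α}
    {mβ : MeasurableSpace β} [IsProbabilityMeasure P] {X : Ω → α} {ξ : Ω → β}
    (h : IndepFun X ξ P) (hX : Measurable X) (hξ : Measurable ξ) {f : α × β → ℝ≥0∞}
    (hf : Measurable f) :
    ∫⁻ ω, f (X ω, ξ ω) ∂P = ∫⁻ ω, ∫⁻ w, f (X ω, w) ∂(P.map ξ) ∂P := by
  have := Measure.isProbabilityMeasure_map hξ.aemeasurable (μ := P)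
  have e := (indepFun_iff_map_prod_eq_prod_map_map hX.aemeasurable hξ.aemeasurable).1 h
  rw [← lintegral_map (f := f) (g := fun ω => (X ω, ξ ω)) hf (hX.prodMk hξ), e,
    lintegral_prod _ hf.aemeasurable, lintegral_map hf.lintegral_prod_right' hX]

/-- A maximal inequality for a nonnegative process that is a supermartingale as long as it stays
in the sets `A k`. -/
theorem mul_measure_exists_ge_le (F : ℕ → MeasurableSpace Ω) (hF : ∀ k, F k ≤ mΩ)
    (hmono : Monotone F) (u : ℕ → Ω → ℝ≥0∞) (hu : ∀ k, Measurable[F k] (u k))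
    (A : ℕ → Set Ω) (hA : ∀ k, MeasurableSet[F k] (A k))
    (hstep : ∀ k (G : Set Ω), MeasurableSet[F k] G → G ⊆ A k →
      ∫⁻ ω in G, u (k + 1) ω ∂P ≤ ∫⁻ ω in G, u k ω ∂P) (l : ℝ≥0∞) (K : ℕ) :
    l * P {ω | ∃ j ≤ K, l ≤ u j ω} ≤ ∫⁻ ω, u 0 ω ∂P + l * P {ω | ∃ i < K, ω ∉ A i} := by
  -- `G k`: up to time `k` the process has neither left the sets `A` nor reached `l`. `B k`: it has
  -- reached `l` by time `k`, without leaving `A` before that.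
  let G : ℕ → Set Ω := fun k => {ω | ∀ i ≤ k, ω ∈ A i ∧ u i ω < l}
  let B : ℕ → Set Ω := fun k => {ω | ∃ j ≤ k, l ≤ u j ω ∧ ∀ i < j, ω ∈ A i ∧ u i ω < l}
  have hGF : ∀ k, MeasurableSet[F k] (G k) := by
    intro k
    have e : G k = ⋂ i : ℕ, ⋂ _ : i ≤ k, (A i ∩ {ω | u i ω < l}) := by
      ext ω; simp [G]
    rw [e]
    refine MeasurableSet.iInter fun i => MeasurableSet.iInter fun hi => ?_
    exact (hmono hi _ (hA i)).inter (hmono hi _ (hu i measurableSet_Iio))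
  have hG : ∀ k, MeasurableSet (G k) := fun k => hF k _ (hGF k)
  have hum : ∀ k, Measurable (u k) := fun k => (hu k).mono (hF k) le_rfl
  have key : ∀ k, ∫⁻ ω in G k, u k ω ∂P + l * P (B k) ≤ ∫⁻ ω, u 0 ω ∂P := by
    intro k
    induction k with
    | zero =>
      have hB0 : B 0 ⊆ {ω | l ≤ u 0 ω} := by
        rintro ω ⟨j, hj, h, -⟩
        obtain rfl : j = 0 := by omega
        exact h
      have hBm : MeasurableSet {ω | l ≤ u 0 ω} := hum 0 measurableSet_Ici
      calc ∫⁻ ω in G 0, u 0 ω ∂P + l * P (B 0)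
          ≤ ∫⁻ ω in {ω | l ≤ u 0 ω}ᶜ, u 0 ω ∂P + ∫⁻ ω in {ω | l ≤ u 0 ω}, u 0 ω ∂P := by
            refine add_le_add (lintegral_mono_set ?_) ?_
            · intro ω hω
              exact not_le.2 (hω 0 le_rfl).2
            · calc l * P (B 0) ≤ l * P {ω | l ≤ u 0 ω} := by gcongr
                _ = ∫⁻ _ in {ω | l ≤ u 0 ω}, l ∂P := by rw [setLIntegral_const]
                _ ≤ _ := setLIntegral_mono (hum 0) fun ω hω => hω
        _ = _ := by rw [add_comm, lintegral_add_compl _ hBm]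
    | succ k ih =>
      -- The paths that reach `l` at time `k + 1` for the first time; splitting them off `G k` costs
      -- at most what `hstep` allows.
      set C : Set Ω := G k ∩ {ω | l ≤ u (k + 1) ω} with hC
      have hCm : MeasurableSet C := (hG k).inter (hum _ measurableSet_Ici)
      have hB : B (k + 1) ⊆ B k ∪ C := by
        rintro ω ⟨j, hj, h, h'⟩
        rcases Nat.lt_or_ge k j with hkj | hkj
        · obtain rfl : j = k + 1 := by omega
          exact Or.inr ⟨fun i hi => h' i (by omega), h⟩
        · exact Or.inl ⟨j, hkj, h, h'⟩
      have h1 : ∫⁻ ω in G (k + 1), u (k + 1) ω ∂P + l * P C ≤ ∫⁻ ω in G k, u k ω ∂P := by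
        calc ∫⁻ ω in G (k + 1), u (k + 1) ω ∂P + l * P C
            ≤ ∫⁻ ω in G k \ C, u (k + 1) ω ∂P + ∫⁻ ω in C, u (k + 1) ω ∂P := by
              refine add_le_add (lintegral_mono_set ?_) ?_
              · intro ω hω
                refine ⟨fun i hi => hω i (by omega), fun hc => ?_⟩
                exact absurd hc.2 (not_le.2 (hω (k + 1) le_rfl).2)
              · calc l * P C = ∫⁻ _ in C, l ∂P := by rw [setLIntegral_const]
                  _ ≤ _ := setLIntegral_mono (hum _) fun ω hω => hω.2
          _ = ∫⁻ ω in G k, u (k + 1) ω ∂P := by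
              rw [add_comm, ← lintegral_inter_add_sdiff (u (k + 1)) (G k) hCm,
                Set.inter_eq_self_of_subset_right (Set.inter_subset_left : C ⊆ G k)]
          _ ≤ _ := hstep k (G k) (hGF k) fun ω hω => (hω k le_rfl).1
      calc ∫⁻ ω in G (k + 1), u (k + 1) ω ∂P + l * P (B (k + 1))
          ≤ ∫⁻ ω in G (k + 1), u (k + 1) ω ∂P + l * (P (B k) + P C) := by
            gcongr
            exact (measure_mono hB).trans (measure_union_le _ _)
        _ = (∫⁻ ω in G (k + 1), u (k + 1) ω ∂P + l * P C) + l * P (B k) := by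
            rw [mul_add]; ring
        _ ≤ _ := (add_le_add h1 le_rfl).trans ih
  have hsub : {ω | ∃ j ≤ K, l ≤ u j ω} ⊆ B K ∪ {ω | ∃ i < K, ω ∉ A i} := by
    rintro ω ⟨j, hj, h⟩
    by_cases hbad : ∃ i < K, ω ∉ A i
    · exact Or.inr hbad
    · push Not at hbad
      classical
      have hex : ∃ j, l ≤ u j ω := ⟨j, h⟩
      refine Or.inl ⟨Nat.find hex, (Nat.find_min' hex h).trans hj, Nat.find_spec hex, ?_⟩
      intro i hi
      exact ⟨hbad i (hi.trans_le ((Nat.find_min' hex h).trans hj)), not_le.1 (Nat.find_min hex hi)⟩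
  calc l * P {ω | ∃ j ≤ K, l ≤ u j ω} ≤ l * (P (B K) + P {ω | ∃ i < K, ω ∉ A i}) := by
        gcongr
        exact (measure_mono hsub).trans (measure_union_le _ _)
    _ ≤ _ := by
        rw [mul_add]
        gcongr
        exact le_add_self.trans (key K)

end Discrete

section Euler

variable {Ω : Type*} {mΩ : MeasurableSpace Ω} {n m : ℕ}

theorem abs_apply_le_frob (A : Matrix (Fin n) (Fin m) ℝ) (i : Fin n) (j : Fin m) :
    |A i j| ≤ frob A := by
  refine Real.abs_le_sqrt ?_
  refine (Finset.single_le_sum (f := fun j => A i j ^ 2) (fun j _ => sq_nonneg _)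
    (Finset.mem_univ j)).trans ?_
  exact Finset.single_le_sum (f := fun i => ∑ j, A i j ^ 2)
    (fun i _ => Finset.sum_nonneg fun j _ => sq_nonneg _) (Finset.mem_univ i)

theorem continuous_of_frob_le {σ : EuclideanSpace ℝ (Fin n) → Matrix (Fin n) (Fin m) ℝ} {L : ℝ}
    (h : ∀ x y, frob (σ y - σ x) ≤ L * ‖y - x‖) : Continuous σ := by
  refine continuous_matrix fun i j => ?_
  refine continuous_iff_continuousAt.2 fun x => ?_
  refine tendsto_iff_norm_sub_tendsto_zero.2 ?_
  have h0 : Tendsto (fun y => L * ‖y - x‖) (𝓝 x) (𝓝 0) := by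
    have : Continuous fun y : EuclideanSpace ℝ (Fin n) => L * ‖y - x‖ := by fun_prop
    simpa using this.tendsto x
  refine squeeze_zero (fun _ => norm_nonneg _) (fun y => ?_) h0
  rw [Real.norm_eq_abs]
  exact (abs_apply_le_frob (σ y - σ x) i j).trans (h x y)

theorem continuous_of_norm_le {b : EuclideanSpace ℝ (Fin n) → EuclideanSpace ℝ (Fin n)} {L : ℝ}
    (h : ∀ x y, ‖b y - b x‖ ≤ L * ‖y - x‖) : Continuous b := by
  refine continuous_iff_continuousAt.2 fun x => tendsto_iff_norm_sub_tendsto_zero.2 ?_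
  have h0 : Tendsto (fun y => L * ‖y - x‖) (𝓝 x) (𝓝 0) := by
    have : Continuous fun y : EuclideanSpace ℝ (Fin n) => L * ‖y - x‖ := by fun_prop
    simpa using this.tendsto x
  exact squeeze_zero (fun _ => norm_nonneg _) (fun y => h x y) h0

/-- The discretization of the right-hand side of the equation along the dyadic grid of mesh
`2⁻ᴺ`, with the coefficients evaluated along `X`. -/
noncomputable def gridSum (D : Data n m) (W : Fin m → ℝ≥0 → Ω → ℝ) (x : EuclideanSpace ℝ (Fin n))
    (X : ℝ≥0 → Ω → EuclideanSpace ℝ (Fin n)) (N k : ℕ) (ω : Ω) : EuclideanSpace ℝ (Fin n) :=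
  x + ∑ j ∈ Finset.range k, ((((2 ^ N : ℝ≥0)⁻¹ : ℝ≥0) : ℝ) • D.b (X ((j : ℝ≥0) / 2 ^ N) ω) +
    WithLp.toLp 2 (D.σ (X ((j : ℝ≥0) / 2 ^ N) ω) *ᵥ
      fun i => W i (((j : ℝ≥0) + 1) / 2 ^ N) ω - W i ((j : ℝ≥0) / 2 ^ N) ω))

variable {P : Measure Ω} [P.IsComplete] {W : Fin m → ℝ≥0 → Ω → ℝ}

theorem measurable_brownianFiltration (hW : IsBrownianMotion W P) (j : Fin m) {s t : ℝ≥0}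
    (hst : s ≤ t) : Measurable[brownianFiltration hW t] (W j s) := by
  have h : Measurable[nullGenerated hW t] (W j s) := by
    refine Measurable.mono (comap_measurable (W j s)) ?_ le_rfl
    exact le_sup_of_le_left (le_iSup_of_le j (le_iSup₂_of_le s hst le_rfl))
  exact h.mono (Filtration.le_rightCont (nullGenerated hW) t) le_rfl

theorem measurable_gridSum {D : Data n m} (hb : Continuous D.b) (hσ : Continuous D.σ)
    (hW : IsBrownianMotion W P) {X : ℝ≥0 → Ω → EuclideanSpace ℝ (Fin n)}
    (hX : ∀ t, Measurable[brownianFiltration hW t] (X t)) (x : EuclideanSpace ℝ (Fin n))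
    (N k : ℕ) : Measurable[brownianFiltration hW ((k : ℝ≥0) / 2 ^ N)] (gridSum D W x X N k) := by
  unfold gridSum
  refine Measurable.const_add ?_ x
  refine Finset.measurable_fun_sum _ fun j hj => ?_
  have hjk : j + 1 ≤ k := by simpa using hj
  have h1 : ((j : ℝ≥0) + 1) / 2 ^ N ≤ (k : ℝ≥0) / 2 ^ N := by
    gcongr; exact_mod_cast hjk
  have h0 : (j : ℝ≥0) / 2 ^ N ≤ ((j : ℝ≥0) + 1) / 2 ^ N := by gcongr; simp
  have hXj : Measurable[brownianFiltration hW ((k : ℝ≥0) / 2 ^ N)] (X ((j : ℝ≥0) / 2 ^ N)) :=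
    (hX _).mono ((brownianFiltration hW).mono (h0.trans h1)) le_rfl
  refine Measurable.add ((hb.const_smul (((2 ^ N : ℝ≥0)⁻¹ : ℝ≥0) : ℝ)).measurable.comp hXj) ?_
  have hc : Continuous fun p : EuclideanSpace ℝ (Fin n) × (Fin m → ℝ) =>
      (WithLp.toLp 2 (D.σ p.1 *ᵥ p.2) : EuclideanSpace ℝ (Fin n)) :=
    (PiLp.continuous_toLp 2 _).comp
      (Continuous.matrix_mulVec (hσ.comp continuous_fst) continuous_snd)
  refine hc.measurable.comp (hXj.prodMk ?_)
  refine @measurable_pi_lambda _ _ _ (brownianFiltration hW ((k : ℝ≥0) / 2 ^ N)) _ _ fun i => ?_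
  exact (measurable_brownianFiltration hW i h1).sub
    (measurable_brownianFiltration hW i (h0.trans h1))

end Euler

end EntropyOS

/-! ### The localized supermartingale property on the grid. -/

namespace EntropyOS

section Supermartingale

theorem measurableSet_norm_sub_le {α E : Type*} {mα : MeasurableSpace α} [NormedAddCommGroup E]
    [MeasurableSpace E] [BorelSpace E] [SecondCountableTopology E] {f g : α → E}
    (hf : Measurable f) (hg : Measurable g) (δ : ℝ) : MeasurableSet {ω | ‖f ω - g ω‖ ≤ δ} :=
  (hf.sub hg).norm measurableSet_Iic

theorem measurable_indicator_prodMk {α β γ : Type*} {mα : MeasurableSpace α} [MeasurableSpace β]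
    [MeasurableSpace γ] {G : Set α} (hG : MeasurableSet G) {f : α → β} {g : α → γ}
    (hf : Measurable f) (hg : Measurable g) :
    Measurable fun a => ((G.indicator 1 a : ℝ≥0∞), f a, g a) :=
  (measurable_one.indicator hG).prodMk (hf.prodMk hg)

variable {Ω : Type*} {mΩ : MeasurableSpace Ω} {n m : ℕ} {P : Measure Ω} [IsProbabilityMeasure P]
  [P.IsComplete] {W : Fin m → ℝ≥0 → Ω → ℝ}

theorem gridSum_succ (D : Data n m) (W : Fin m → ℝ≥0 → Ω → ℝ) (x : EuclideanSpace ℝ (Fin n))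
    (X : ℝ≥0 → Ω → EuclideanSpace ℝ (Fin n)) (N k : ℕ) (ω : Ω) :
    gridSum D W x X N (k + 1) ω = gridSum D W x X N k ω +
      (((2 ^ N : ℝ≥0)⁻¹ : ℝ≥0) : ℝ) • D.b (X ((k : ℝ≥0) / 2 ^ N) ω) +
      WithLp.toLp 2 (D.σ (X ((k : ℝ≥0) / 2 ^ N) ω) *ᵥ
        fun i => W i (((k : ℝ≥0) + 1) / 2 ^ N) ω - W i ((k : ℝ≥0) / 2 ^ N) ω) := by
  simp only [gridSum, Finset.sum_range_succ]
  abel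

/-- The coefficients are evaluated at `x` but measured against `y`, at the price of factors `1 + δ`.
As `δ → 0` the last two constants tend to `3L` and `2L²`, which produce the threshold imposed on the
discount rate. -/
theorem coefficient_bounds {D : Data n m} {L δ : ℝ} (hL : 0 < L) (hδ : 0 ≤ δ)
    (hb : ∀ x, ‖D.b x‖ ≤ L * (1 + ‖x‖)) (hσ : ∀ x, frob (D.σ x) ≤ L * (1 + ‖x‖))
    {x y : EuclideanSpace ℝ (Fin n)} (hxy : ‖x - y‖ ≤ δ) :
    ‖D.b x‖ ≤ 2 * L * (1 + δ) * √(1 + ‖y‖ ^ 2) ∧ frob (D.σ x) ≤ 2 * L * (1 + δ) * √(1 + ‖y‖ ^ 2) ∧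
    2 * inner ℝ y (D.b x) ≤ 3 * L * (1 + δ) * (1 + ‖y‖ ^ 2) ∧
    frob (D.σ x) ^ 2 ≤ 2 * L ^ 2 * (1 + δ) ^ 2 * (1 + ‖y‖ ^ 2) := by
  have hy := norm_nonneg y
  have h1 : L * (1 + ‖x‖) ≤ L * ((1 + δ) * (1 + ‖y‖)) := by
    have : ‖x‖ ≤ ‖x - y‖ + ‖y‖ := by simpa using norm_add_le (x - y) y
    gcongr
    nlinarith
  have h2 : 1 + ‖y‖ ≤ 2 * √(1 + ‖y‖ ^ 2) := by
    have a1 : (1 : ℝ) ≤ √(1 + ‖y‖ ^ 2) := Real.one_le_sqrt.2 (by nlinarith)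
    have a2 : ‖y‖ ≤ √(1 + ‖y‖ ^ 2) := Real.le_sqrt_of_sq_le (by linarith)
    linarith
  have h3 : L * ((1 + δ) * (1 + ‖y‖)) ≤ 2 * L * (1 + δ) * √(1 + ‖y‖ ^ 2) := by
    calc L * ((1 + δ) * (1 + ‖y‖)) ≤ L * ((1 + δ) * (2 * √(1 + ‖y‖ ^ 2))) := by gcongr
      _ = _ := by ring
  refine ⟨(hb x).trans (h1.trans h3), (hσ x).trans (h1.trans h3), ?_, ?_⟩
  · have : inner ℝ y (D.b x) ≤ ‖y‖ * (L * ((1 + δ) * (1 + ‖y‖))) :=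
      (real_inner_le_norm _ _).trans (mul_le_mul_of_nonneg_left ((hb x).trans h1) hy)
    have h4 : 2 * (‖y‖ * (1 + ‖y‖)) ≤ 3 * (1 + ‖y‖ ^ 2) := by nlinarith [sq_nonneg (‖y‖ - 1)]
    calc 2 * inner ℝ y (D.b x) ≤ L * (1 + δ) * (2 * (‖y‖ * (1 + ‖y‖))) := by linarith
      _ ≤ L * (1 + δ) * (3 * (1 + ‖y‖ ^ 2)) := by gcongr
      _ = _ := by ring
  · calc frob (D.σ x) ^ 2 ≤ (L * ((1 + δ) * (1 + ‖y‖))) ^ 2 := by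
          gcongr
          · exact frob_nonneg _
          · exact (hσ x).trans h1
      _ = L ^ 2 * (1 + δ) ^ 2 * (1 + ‖y‖) ^ 2 := by ring
      _ ≤ L ^ 2 * (1 + δ) ^ 2 * (2 * (1 + ‖y‖ ^ 2)) := by
          gcongr
          nlinarith [sq_nonneg (‖y‖ - 1)]
      _ = _ := by ring

/-- The maximal inequality for the discounted powers of the grid sums. The one-step estimate applies
only while the sum is within `δ` of `X`, hence the second term on the right. -/
theorem measure_exists_gridSum_ge_le {D : Data n m} {L δ κ : ℝ} (hL : 0 < L) (hδ : 0 ≤ δ)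
    (hb : ∀ x, ‖D.b x‖ ≤ L * (1 + ‖x‖)) (hσ : ∀ x, frob (D.σ x) ≤ L * (1 + ‖x‖))
    (hbc : Continuous D.b) (hσc : Continuous D.σ) {q : ℕ} (hq : 1 ≤ q)
    (hκ : q * (3 * L * (1 + δ)) + (2 * q ^ 2 - q) * (2 * L ^ 2 * (1 + δ) ^ 2) < κ)
    (hW : IsBrownianMotion W P) {X : ℝ≥0 → Ω → EuclideanSpace ℝ (Fin n)}
    (hX : ∀ t, Measurable[brownianFiltration hW t] (X t)) (x : EuclideanSpace ℝ (Fin n)) :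
    ∃ N₀ : ℕ, ∀ N ≥ N₀, ∀ (l : ℝ≥0∞) (K : ℕ),
      l * P {ω | ∃ j ≤ K, l ≤ ENNReal.ofReal (Real.exp (-κ * (j / 2 ^ N)) *
        (1 + ‖gridSum D W x X N j ω‖ ^ 2) ^ q)} ≤
      ENNReal.ofReal ((1 + ‖x‖ ^ 2) ^ q) +
        l * P {ω | ∃ i < K, δ < ‖X ((i : ℝ≥0) / 2 ^ N) ω - gridSum D W x X N i ω‖} := by
  obtain ⟨h₀, hh₀, H⟩ := exists_mesh_lintegral_le (n := n) (m := m) q hq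
    (c := 2 * L * (1 + δ)) (by positivity) hκ
  obtain ⟨N₀, hN₀⟩ := exists_pow_lt_of_lt_one hh₀ (by norm_num : (1 / 2 : ℝ) < 1)
  refine ⟨N₀, fun N hN l K => ?_⟩
  set h : ℝ≥0 := (2 ^ N)⁻¹ with hh
  have hhr : (h : ℝ) = (1 / 2) ^ N := by simp [hh]
  have hle : (h : ℝ) ≤ h₀ := by
    rw [hhr]
    exact (pow_le_pow_of_le_one (by norm_num) (by norm_num) hN).trans hN₀.le
  have hpos : 0 < h := by positivity
  let F : ℕ → MeasurableSpace Ω := fun k => brownianFiltration hW ((k : ℝ≥0) / 2 ^ N)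
  let Y : ℕ → Ω → EuclideanSpace ℝ (Fin n) := gridSum D W x X N
  let φ : ℕ → EuclideanSpace ℝ (Fin n) → ℝ≥0∞ := fun k y =>
    ENNReal.ofReal (Real.exp (-κ * (k / 2 ^ N)) * (1 + ‖y‖ ^ 2) ^ q)
  have hφ : ∀ k, Measurable (φ k) := fun k => by
    have : Continuous fun y : EuclideanSpace ℝ (Fin n) =>
      Real.exp (-κ * (k / 2 ^ N)) * (1 + ‖y‖ ^ 2) ^ q := by fun_prop
    exact this.measurable.ennreal_ofReal
  have hFm : Monotone F := fun i j hij => (brownianFiltration hW).mono (by gcongr)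
  have hY : ∀ k, Measurable[F k] (Y k) := fun k => measurable_gridSum hbc hσc hW hX x N k
  have hmax := mul_measure_exists_ge_le (P := P) F (fun k => (brownianFiltration hW).le _) hFm
    (fun k ω => φ k (Y k ω)) (fun k => (hφ k).comp (hY k))
    (fun k => {ω | ‖X ((k : ℝ≥0) / 2 ^ N) ω - Y k ω‖ ≤ δ})
    (fun k => measurableSet_norm_sub_le (hX _) (hY k) δ) ?_ l K
  · have e0 : ∫⁻ ω, φ 0 (Y 0 ω) ∂P = ENNReal.ofReal ((1 + ‖x‖ ^ 2) ^ q) := by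
      simp [φ, Y, gridSum]
    rw [e0] at hmax
    simpa only [Set.mem_ofPred_eq, not_le] using hmax
  intro k G hG hGA
  set t : ℝ≥0 := (k : ℝ≥0) / 2 ^ N with ht
  have ht1 : ((k : ℝ≥0) + 1) / 2 ^ N = t + h := by rw [ht, hh, add_div, one_div]
  let ξ : Ω → Fin m → ℝ := fun ω i => W i (t + h) ω - W i t ω
  have hξ : Measurable ξ := hW.measurable_increment t (t + h)
  let V := EuclideanSpace ℝ (Fin n)
  -- The indicator of `G` is carried as a coordinate, so that the restricted integral is one
  -- function of the past `U` and the independent increment `ξ`.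
  let U : Ω → ℝ≥0∞ × V × V := fun ω => (G.indicator 1 ω, X t ω, Y k ω)
  have hU : Measurable[brownianFiltration hW t] U :=
    measurable_indicator_prodMk hG (hX t) (hY k)
  have hind : IndepFun U ξ P :=
    indep_of_indep_of_le_left (brownianFiltration_indep hW (lt_add_of_pos_right t hpos)) hU.comap_le
  have hUm : Measurable U := hU.mono ((brownianFiltration hW).le t) le_rfl
  have hGm : MeasurableSet G := (brownianFiltration hW).le t G hG
  let ψ : (ℝ≥0∞ × V × V) × (Fin m → ℝ) → V := fun p =>
    p.1.2.2 + (h : ℝ) • D.b p.1.2.1 + WithLp.toLp 2 (D.σ p.1.2.1 *ᵥ p.2)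
  have hψ : Continuous ψ := by
    have hc : Continuous fun p : (ℝ≥0∞ × V × V) × (Fin m → ℝ) =>
        (WithLp.toLp 2 (D.σ p.1.2.1 *ᵥ p.2) : V) :=
      (PiLp.continuous_toLp 2 _).comp
        (Continuous.matrix_mulVec (hσc.comp
          (f := fun p : (ℝ≥0∞ × V × V) × (Fin m → ℝ) => p.1.2.1) (by fun_prop)) continuous_snd)
    have hc2 : Continuous fun p : (ℝ≥0∞ × V × V) × (Fin m → ℝ) => (h : ℝ) • D.b p.1.2.1 :=
      (hbc.const_smul (h : ℝ)).comp
        (f := fun p : (ℝ≥0∞ × V × V) × (Fin m → ℝ) => p.1.2.1) (by fun_prop)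
    exact (Continuous.add (by fun_prop) hc2).add hc
  let f : (ℝ≥0∞ × V × V) × (Fin m → ℝ) → ℝ≥0∞ := fun p => p.1.1 * φ (k + 1) (ψ p)
  have hf : Measurable f := (measurable_fst.comp measurable_fst).mul ((hφ _).comp hψ.measurable)
  have hYs : ∀ ω, Y (k + 1) ω = ψ (U ω, ξ ω) := by
    intro ω
    have := gridSum_succ D W x X N k ω
    rw [ht1] at this
    exact this
  have hexp : Real.exp (-κ * ((k + 1 : ℕ) / 2 ^ N)) * Real.exp (κ * h) =
      Real.exp (-κ * (k / 2 ^ N)) := by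
    rw [← Real.exp_add]
    congr 1
    rw [show (h : ℝ) = (2 ^ N)⁻¹ by simp [hh]]
    push_cast
    field_simp
    ring
  calc ∫⁻ ω in G, φ (k + 1) (Y (k + 1) ω) ∂P
      = ∫⁻ ω, f (U ω, ξ ω) ∂P := by
        rw [← lintegral_indicator hGm]
        refine lintegral_congr fun ω => ?_
        by_cases hω : ω ∈ G <;> simp [f, U, hω, hYs]
    _ = ∫⁻ ω, ∫⁻ w, f (U ω, w) ∂(Measure.pi fun _ => gaussianReal 0 h) ∂P := by
        rw [← hW.map_increment t h]
        exact IndepFun.lintegral_comp_prod hind hUm hξ hf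
    _ ≤ ∫⁻ ω, G.indicator (fun ω => φ k (Y k ω)) ω ∂P := by
        refine lintegral_mono fun ω => ?_
        by_cases hω : ω ∈ G
        swap
        · simp [f, U, hω]
        obtain ⟨c1, c2, c3, c4⟩ := coefficient_bounds hL hδ hb hσ (hGA hω)
        have := H h hle (Y k ω) (D.b (X t ω)) (D.σ (X t ω)) c1 c2 c3 c4
        simp only [f, U, hω, Set.indicator_of_mem, Pi.one_apply, one_mul, φ, ψ]
        simp_rw [ENNReal.ofReal_mul (Real.exp_nonneg _)]
        rw [lintegral_const_mul']
        swap
        · exact ENNReal.ofReal_ne_top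
        refine (mul_le_mul_right this _).trans_eq ?_
        rw [← ENNReal.ofReal_mul (Real.exp_nonneg _), ← ENNReal.ofReal_mul (Real.exp_nonneg _),
          ← hexp]
        congr 1
        ring
    _ = ∫⁻ ω in G, φ k (Y k ω) ∂P := lintegral_indicator hGm _

end Supermartingale

end EntropyOS

/-! ### Convergence of the grid sums to the solution. -/

namespace EntropyOS

section Limit

variable {Ω : Type*} {mΩ : MeasurableSpace Ω} {P : Measure Ω}

/-- Paths are continuous only almost surely; joint measurability is obtained from this version.
Adaptedness is lost, but it is not needed for that. -/
theorem exists_continuous_version {E : Type*} [TopologicalSpace E] [MeasurableSpace E] [Nonempty E]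
    {X : ℝ≥0 → Ω → E} (hX : ∀ t, Measurable (X t))
    (hc : ∀ᵐ ω ∂P, Continuous fun t => X t ω) :
    ∃ X' : ℝ≥0 → Ω → E, (∀ t, Measurable (X' t)) ∧ (∀ ω, Continuous fun t => X' t ω) ∧
      ∀ᵐ ω ∂P, ∀ t, X t ω = X' t ω := by
  classical
  obtain ⟨s, hs, hsm, hPs⟩ := exists_measurable_superset_of_null (ae_iff.1 hc)
  obtain ⟨e⟩ := ‹Nonempty E›
  refine ⟨fun t ω => if ω ∈ s then e else X t ω, fun t => ?_, fun ω => ?_, ?_⟩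
  · exact Measurable.ite hsm measurable_const (hX t)
  · by_cases hω : ω ∈ s
    · simpa [hω] using continuous_const
    · simp only [hω, if_false]
      by_contra h
      exact hω (hs h)
  · have : ∀ᵐ ω ∂P, ω ∉ s := measure_eq_zero_iff_ae_notMem.1 hPs
    filter_upwards [this] with ω hω t
    simp [hω]

theorem exists_dyadic_eq {T T' N N' j : ℕ} (hT : T ≤ T') (hN : N ≤ N') (hj : j ≤ T * 2 ^ N) :
    ∃ j' ≤ T' * 2 ^ N', ((j' : ℝ≥0) / 2 ^ N') = (j : ℝ≥0) / 2 ^ N := by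
  obtain ⟨d, rfl⟩ := Nat.exists_eq_add_of_le hN
  refine ⟨j * 2 ^ d, ?_, ?_⟩
  · rw [pow_add, ← mul_assoc]
    exact Nat.mul_le_mul_right _ (hj.trans (Nat.mul_le_mul_right _ hT))
  · push_cast
    rw [pow_add]
    field_simp

/-- Level and horizon are the same `N`, so a single increasing sequence of finite grids exhausts a
dense set of times. -/
theorem exists_dyadic_mem {U : Set ℝ≥0} (hU : IsOpen U) {t : ℝ≥0} (ht : t ∈ U) :
    ∃ N j : ℕ, j ≤ N * 2 ^ N ∧ (j : ℝ≥0) / 2 ^ N ∈ U := by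
  have h1 : Tendsto (fun N : ℕ => ((⌊(t : ℝ) * 2 ^ N⌋₊ : ℝ) / 2 ^ N)) atTop (𝓝 (t : ℝ)) :=
    (tendsto_nat_floor_mul_div_atTop t.coe_nonneg).comp
      (tendsto_pow_atTop_atTop_of_one_lt (by norm_num : (1 : ℝ) < 2))
  have h2 : Tendsto (fun N : ℕ => ((⌊(t : ℝ) * 2 ^ N⌋₊ : ℝ≥0) / 2 ^ N)) atTop (𝓝 t) := by
    rw [← NNReal.tendsto_coe]
    simpa using h1
  obtain ⟨N₀, hN₀⟩ := exists_nat_ge (t : ℝ)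
  obtain ⟨N, hNU, hNN⟩ := ((h2.eventually (hU.mem_nhds ht)).and (eventually_ge_atTop N₀)).exists
  refine ⟨N, ⌊(t : ℝ) * 2 ^ N⌋₊, ?_, hNU⟩
  refine Nat.floor_le_of_le ?_
  push_cast
  gcongr
  exact hN₀.trans (by exact_mod_cast hNN)

theorem eventually_riemann_sum_lt {E : Type*} [NormedAddCommGroup E] [NormedSpace ℝ E]
    [CompleteSpace E] {f : ℝ≥0 → E} (hf : Continuous f) (T : ℕ) {ε : ℝ} (hε : 0 < ε) :
    ∀ᶠ N : ℕ in atTop, ∀ i ≤ T * 2 ^ N,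
      ‖(∫ s in (0 : ℝ)..((i : ℝ) / 2 ^ N), f s.toNNReal) -
        ∑ j ∈ Finset.range i, ((2 : ℝ) ^ N)⁻¹ • f ((j : ℝ≥0) / 2 ^ N)‖ < ε := by
  set g : ℝ → E := fun s => f s.toNNReal with hg
  have hgc : Continuous g := hf.comp continuous_real_toNNReal
  have huc := (isCompact_Icc (a := (0 : ℝ)) (b := T)).uniformContinuousOn_of_continuous
    hgc.continuousOn
  rw [Metric.uniformContinuousOn_iff] at huc
  -- Dividing by `T + 1` rather than `T` keeps the quotient meaningful at `T = 0` and the final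
  -- inequality strict.
  obtain ⟨η, hη, H⟩ := huc (ε / (T + 1)) (by positivity)
  obtain ⟨N₀, hN₀⟩ := exists_pow_lt_of_lt_one hη (by norm_num : (1 / 2 : ℝ) < 1)
  filter_upwards [eventually_ge_atTop N₀] with N hN i hi
  have hh : ((2 : ℝ) ^ N)⁻¹ < η := by
    have : ((2 : ℝ) ^ N)⁻¹ = (1 / 2) ^ N := by simp
    rw [this]
    exact (pow_le_pow_of_le_one (by norm_num) (by norm_num) hN).trans_lt hN₀
  have h2 : (0 : ℝ) < 2 ^ N := by positivity
  have hint : ∀ a b, IntervalIntegrable g volume a b := fun a b => hgc.intervalIntegrable a b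
  have hsum := intervalIntegral.sum_integral_adjacent_intervals (f := g) (μ := volume)
    (a := fun k : ℕ => (k : ℝ) / 2 ^ N) (n := i) fun k _ => hint _ _
  simp only [Nat.cast_zero, zero_div] at hsum
  rw [← hsum, ← Finset.sum_sub_distrib]
  have hterm : ∀ j ∈ Finset.range i, ‖(∫ s in (j : ℝ) / 2 ^ N..((j + 1 : ℕ) : ℝ) / 2 ^ N, g s) -
      ((2 : ℝ) ^ N)⁻¹ • f ((j : ℝ≥0) / 2 ^ N)‖ ≤ ε / (T + 1) * ((2 : ℝ) ^ N)⁻¹ := by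
    intro j hj
    have hji : j + 1 ≤ i := by simpa using hj
    have hjT : ((j + 1 : ℕ) : ℝ) / 2 ^ N ≤ T := by
      rw [div_le_iff₀ h2]
      exact_mod_cast hji.trans hi
    have hlen : ((j + 1 : ℕ) : ℝ) / 2 ^ N - (j : ℝ) / 2 ^ N = ((2 : ℝ) ^ N)⁻¹ := by
      push_cast; field_simp; ring
    have hfj : f ((j : ℝ≥0) / 2 ^ N) = g ((j : ℝ) / 2 ^ N) := by
      rw [hg]
      congr 1
      ext
      rw [Real.coe_toNNReal _ (by positivity)]
      simp
    have hc : ((2 : ℝ) ^ N)⁻¹ • f ((j : ℝ≥0) / 2 ^ N) =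
        ∫ _ in (j : ℝ) / 2 ^ N..((j + 1 : ℕ) : ℝ) / 2 ^ N, g ((j : ℝ) / 2 ^ N) := by
      rw [intervalIntegral.integral_const, hlen, hfj]
    rw [hc, ← intervalIntegral.integral_sub (hint _ _) (by simp)]
    refine (intervalIntegral.norm_integral_le_of_norm_le_const (C := ε / (T + 1)) ?_).trans_eq ?_
    · intro s hs
      rw [Set.uIoc_of_le (by rw [← sub_nonneg, hlen]; positivity)] at hs
      have hj0 : 0 ≤ (j : ℝ) / 2 ^ N := by positivity
      rw [← dist_eq_norm]
      refine (H s ⟨hj0.trans hs.1.le, hs.2.trans hjT⟩ _ ⟨hj0, ?_⟩ ?_).le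
      · exact hs.1.le.trans (hs.2.trans hjT)
      · rw [Real.dist_eq, abs_of_pos (by linarith [hs.1])]
        linarith [hs.2]
    · rw [hlen, abs_of_pos (by positivity)]
  calc _ ≤ ∑ j ∈ Finset.range i, ε / (T + 1) * ((2 : ℝ) ^ N)⁻¹ := norm_sum_le_of_le _ hterm
    _ = ε * (i / 2 ^ N / (T + 1)) := by
      rw [Finset.sum_const, Finset.card_range, nsmul_eq_mul]
      field_simp
    _ < ε * 1 := by
      gcongr
      rw [div_lt_one (by positivity)]
      have : (i : ℝ) / 2 ^ N ≤ T := by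
        rw [div_le_iff₀ h2]; exact_mod_cast hi
      linarith
    _ = ε := mul_one ε

variable {n m : ℕ}

theorem itoSum_grid (H : ℝ≥0 → Ω → Matrix (Fin n) (Fin m) ℝ) (W : Fin m → ℝ≥0 → Ω → ℝ)
    (N k : ℕ) (ω : Ω) : itoSum H W N ((k : ℝ≥0) / 2 ^ N) ω =
      ∑ j ∈ Finset.range k, WithLp.toLp 2 (H ((j : ℝ≥0) / 2 ^ N) ω *ᵥ
        fun i => W i (((j : ℝ≥0) + 1) / 2 ^ N) ω - W i ((j : ℝ≥0) / 2 ^ N) ω) := by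
  have e : ⌈(2 ^ N * ((k : ℝ≥0) / 2 ^ N) : ℝ≥0)⌉₊ = k := by
    rw [mul_div_cancel₀ _ (by positivity), Nat.ceil_natCast]
  rw [itoSum, e]
  refine Finset.sum_congr rfl fun j hj => ?_
  have hjk : j + 1 ≤ k := by simpa using hj
  have h1 : ((j : ℝ≥0) + 1) / 2 ^ N ≤ (k : ℝ≥0) / 2 ^ N := by
    gcongr; exact_mod_cast hjk
  have h0 : (j : ℝ≥0) / 2 ^ N ≤ ((j : ℝ≥0) + 1) / 2 ^ N := by gcongr; simp
  rw [min_eq_left h1, min_eq_left (h0.trans h1)]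

/-- Since the coefficients are frozen along `X` itself, the discrepancy is exactly a Riemann-sum
error for the drift and an Itô-sum error. The first tends to zero path by path, the second by the
definition of the integral, and no Gronwall argument is needed. -/
theorem tendsto_measure_gridSum [IsProbabilityMeasure P] {D : Data n m} (hb : Continuous D.b)
    {𝔽 : Filtration ℝ≥0 mΩ} {W : Fin m → ℝ≥0 → Ω → ℝ} {x : EuclideanSpace ℝ (Fin n)}
    {X : ℝ≥0 → Ω → EuclideanSpace ℝ (Fin n)} (hX : IsSolution D 𝔽 W P x X) (T : ℕ) {δ : ℝ}
    (hδ : 0 < δ) :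
    Tendsto (fun N : ℕ => P {ω | ∃ i ≤ T * 2 ^ N,
      δ < ‖X ((i : ℝ≥0) / 2 ^ N) ω - gridSum D W x X N i ω‖}) atTop (𝓝 0) := by
  obtain ⟨I, hI, hE⟩ := hX.equation
  obtain ⟨X', hX'm, hX'c, hXX'⟩ := exists_continuous_version
    (fun t => (hX.adapted t).mono (𝔽.le t) le_rfl) hX.continuous
  let R : ℕ → ℕ → Ω → EuclideanSpace ℝ (Fin n) := fun N i ω =>
    (∫ s in (0 : ℝ)..((i : ℝ) / 2 ^ N), D.b (X' s.toNNReal ω)) -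
      ∑ j ∈ Finset.range i, ((2 : ℝ) ^ N)⁻¹ • D.b (X' ((j : ℝ≥0) / 2 ^ N) ω)
  have hR : ∀ N i, Measurable (R N i) := by
    intro N i
    refine Measurable.sub ?_ (Finset.measurable_fun_sum _ fun j _ =>
      (hb.const_smul ((2 : ℝ) ^ N)⁻¹).measurable.comp (hX'm _))
    have hm : Measurable (Function.uncurry fun (ω : Ω) (s : ℝ) => D.b (X' s.toNNReal ω)) := by
      have h1 := measurable_uncurry_of_continuous_of_measurable hX'c hX'm
      exact hb.measurable.comp (h1.comp
        ((measurable_real_toNNReal.comp measurable_snd).prodMk measurable_fst))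
    simp_rw [intervalIntegral.integral_of_le (by positivity : (0 : ℝ) ≤ (i : ℝ) / 2 ^ N)]
    exact (hm.stronglyMeasurable.integral_prod_right).measurable
  let C : ℕ → Set Ω := fun N => {ω | ∃ i ≤ T * 2 ^ N, δ / 2 ≤ ‖R N i ω‖}
  have hC : ∀ N, MeasurableSet (C N) := by
    intro N
    have e : C N = ⋃ i : ℕ, ⋃ _ : i ≤ T * 2 ^ N, {ω | δ / 2 ≤ ‖R N i ω‖} := by
      ext ω; simp [C]
    rw [e]
    exact MeasurableSet.iUnion fun i => MeasurableSet.iUnion fun _ =>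
      (hR N i).norm measurableSet_Ici
  have hClim : Tendsto (fun N => P (C N)) atTop (𝓝 0) := by
    have := tendsto_measure_of_ae_tendsto_indicator_of_isFiniteMeasure (μ := P) atTop
      MeasurableSet.empty hC (Eventually.of_forall fun ω => ?_)
    · simpa using this
    · filter_upwards [eventually_riemann_sum_lt (hb.comp (hX'c ω)) T (half_pos hδ)] with N hN
      simp only [C, Set.mem_ofPred_eq, Set.mem_empty_iff_false, iff_false, not_exists, not_and,
        not_le]
      exact hN
  have hIlim := hI T (δ / 2) (half_pos hδ)
  refine tendsto_of_tendsto_of_tendsto_of_le_of_le tendsto_const_nhds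
    (by simpa using hClim.add hIlim) (fun _ => zero_le) fun N => ?_
  have hae : ∀ᵐ ω ∂P, ω ∈ {ω | ∃ i ≤ T * 2 ^ N,
      δ < ‖X ((i : ℝ≥0) / 2 ^ N) ω - gridSum D W x X N i ω‖} → ω ∈ C N ∪ {ω | ∃ t ≤ (T : ℝ≥0),
        δ / 2 ≤ ‖itoSum (fun t ω => D.σ (X t ω)) W N t ω - I t ω‖} := by
    filter_upwards [hE, hXX'] with ω h1 h2 ⟨i, hi, h⟩
    by_contra hcon
    simp only [C, Set.mem_union, Set.mem_ofPred_eq, not_or, not_exists, not_and, not_le] at hcon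
    have hiT : (i : ℝ≥0) / 2 ^ N ≤ T := by
      rw [div_le_iff₀ (by positivity)]; exact_mod_cast hi
    have c1 := hcon.1 i hi
    have c2 := hcon.2 _ hiT
    have e : X ((i : ℝ≥0) / 2 ^ N) ω - gridSum D W x X N i ω =
        R N i ω - (itoSum (fun t ω => D.σ (X t ω)) W N ((i : ℝ≥0) / 2 ^ N) ω -
          I ((i : ℝ≥0) / 2 ^ N) ω) := by
      rw [itoSum_grid, gridSum, Finset.sum_add_distrib, h1]
      simp only [R, ← h2]
      push_cast
      abel
    rw [e] at h
    have := norm_sub_le (R N i ω) (itoSum (fun t ω => D.σ (X t ω)) W N ((i : ℝ≥0) / 2 ^ N) ω -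
          I ((i : ℝ≥0) / 2 ^ N) ω)
    linarith
  exact (measure_mono_ae hae).trans (measure_union_le _ _)

end Limit

end EntropyOS

/-! ### Maximal moment bound for the solution. -/

namespace EntropyOS

section Moment

variable {Ω : Type*} {mΩ : MeasurableSpace Ω} {P : Measure Ω}

/-- The event `U = ∞` lies in every superlevel set, so its probability times any `l` stays below
`C`. -/
theorem ae_lt_top_of_weak_bound {U : Ω → ℝ≥0∞} {C : ℝ}
    (h : ∀ l : ℝ, 0 < l → ENNReal.ofReal l * P {ω | ENNReal.ofReal l < U ω} ≤ ENNReal.ofReal C) :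
    ∀ᵐ ω ∂P, U ω < ∞ := by
  rw [ae_iff]
  by_contra hne
  obtain ⟨k, hk⟩ := ENNReal.exists_nat_mul_gt hne (ENNReal.ofReal_ne_top (r := C))
  have h1 := h (k + 1) (by positivity)
  refine absurd hk (not_lt.2 (le_trans ?_ h1))
  refine mul_le_mul' ?_ (measure_mono fun ω hω => ?_)
  · rw [← ENNReal.ofReal_natCast]
    exact ENNReal.ofReal_le_ofReal (by linarith)
  · simp only [Set.mem_ofPred_eq, not_lt, top_le_iff] at hω
    simp [hω]

variable [IsProbabilityMeasure P]

/-- Layer cake: `E U^θ = θ ∫ t^{θ-1} P(U > t) dt`. Near `0` the probability is at most `1` and `θ >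
0` suffices; at infinity the bound `C/t` leaves `t^{θ-2}`, integrable because `θ < 1`. -/
theorem integrable_rpow_of_weak_bound {U : Ω → ℝ≥0∞} (hU : Measurable U) {C θ : ℝ} (hC : 0 ≤ C)
    (h : ∀ l : ℝ, 0 < l → ENNReal.ofReal l * P {ω | ENNReal.ofReal l < U ω} ≤ ENNReal.ofReal C)
    (hθ : 0 < θ) (hθ1 : θ < 1) : Integrable (fun ω => (U ω).toReal ^ θ) P := by
  have hm : Measurable fun ω => (U ω).toReal := hU.ennreal_toReal
  have hmθ : Measurable fun ω => (U ω).toReal ^ θ := hm.pow_const θ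
  refine ⟨hmθ.aestronglyMeasurable, ?_⟩
  rw [hasFiniteIntegral_iff_ofReal (Eventually.of_forall fun ω => by positivity),
    lintegral_rpow_eq_lintegral_meas_lt_mul P (Eventually.of_forall fun ω => ENNReal.toReal_nonneg)
      hm.aemeasurable hθ]
  refine ENNReal.mul_lt_top ENNReal.ofReal_lt_top ?_
  have hb : ∀ t : ℝ, 0 < t → P {ω | t < (U ω).toReal} ≤ ENNReal.ofReal (C / t) := by
    intro t ht
    rw [ENNReal.ofReal_div_of_pos ht, ENNReal.le_div_iff_mul_le
      (Or.inl (by simpa using ht)) (Or.inl ENNReal.ofReal_ne_top), mul_comm]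
    refine le_trans ?_ (h t ht)
    gcongr with ω
    intro hω
    exact (ENNReal.ofReal_lt_iff_lt_toReal ht.le
      (by rintro hω'; rw [hω'] at hω; simp at hω; linarith)).2 hω
  rw [← Set.Ioc_union_Ioi_eq_Ioi zero_le_one]
  refine (lintegral_union_le _ _ _).trans_lt (ENNReal.add_lt_top.2 ⟨?_, ?_⟩)
  · have hi : IntegrableOn (fun t : ℝ => t ^ (θ - 1)) (Set.Ioc 0 1) :=
      (intervalIntegral.intervalIntegrable_rpow' (by linarith)).1
    refine lt_of_le_of_lt (setLIntegral_mono' measurableSet_Ioc fun t _ => ?_)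
      hi.lintegral_lt_top
    exact mul_le_of_le_one_left' prob_le_one
  · have hi : IntegrableOn (fun t : ℝ => C * t ^ (θ - 2)) (Set.Ioi 1) :=
      (integrableOn_Ioi_rpow_of_lt (by linarith) one_pos).const_mul C
    refine lt_of_le_of_lt (setLIntegral_mono' measurableSet_Ioi fun t ht => ?_)
      hi.lintegral_lt_top
    have ht0 : (0 : ℝ) < t := one_pos.trans ht
    refine (mul_le_mul_left (hb t ht0) _).trans_eq ?_
    rw [← ENNReal.ofReal_mul (by positivity)]
    congr 1
    rw [show θ - 1 = θ - 2 + 1 by ring, Real.rpow_add_one ht0.ne']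
    field_simp

variable {n m : ℕ} [P.IsComplete] {W : Fin m → ℝ≥0 → Ω → ℝ}

/-- The grid inequality passes to the limit: the probability of being `δ` apart vanishes with the
mesh, and continuity extends the supremum from dyadic times to all times. -/
theorem mul_measure_exists_gt_le {D : Data n m} {L κ : ℝ} (hL : 0 < L)
    (hb : ∀ x, ‖D.b x‖ ≤ L * (1 + ‖x‖)) (hσ : ∀ x, frob (D.σ x) ≤ L * (1 + ‖x‖))
    (hbc : Continuous D.b) (hσc : Continuous D.σ) {q : ℕ} (hq : 1 ≤ q)
    (hκ : q * (3 * L) + (2 * q ^ 2 - q) * (2 * L ^ 2) < κ)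
    (hW : IsBrownianMotion W P) {x : EuclideanSpace ℝ (Fin n)}
    {X : ℝ≥0 → Ω → EuclideanSpace ℝ (Fin n)} (hX : IsSolution D (brownianFiltration hW) W P x X)
    {l : ℝ} (hl : 0 < l) :
    ENNReal.ofReal l * P {ω | ∃ t : ℝ≥0, l < Real.exp (-κ * t) * (1 + ‖X t ω‖ ^ 2) ^ q} ≤
      ENNReal.ofReal (2 ^ q * (1 + ‖x‖ ^ 2) ^ q) := by
  -- Small enough to keep the rate strictly below `κ`. The bound `δ ≤ 1/2` makes `1+|X|²` at most
  -- twice `1+|Y|²`, whence the factor `2 ^ q`.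
  obtain ⟨δ, hδ0, hδ1, hκδ⟩ : ∃ δ : ℝ, 0 < δ ∧ δ ≤ 1 / 2 ∧
      q * (3 * L * (1 + δ)) + (2 * q ^ 2 - q) * (2 * L ^ 2 * (1 + δ) ^ 2) < κ := by
    have hc : Continuous fun δ : ℝ =>
        q * (3 * L * (1 + δ)) + (2 * q ^ 2 - q) * (2 * L ^ 2 * (1 + δ) ^ 2) := by fun_prop
    have h1 : ∀ᶠ δ in 𝓝[>] (0 : ℝ),
        q * (3 * L * (1 + δ)) + (2 * q ^ 2 - q) * (2 * L ^ 2 * (1 + δ) ^ 2) < κ :=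
      (hc.tendsto 0).mono_left nhdsWithin_le_nhds |>.eventually_lt_const (by simpa using hκ)
    obtain ⟨δ, h, h0⟩ := (h1.and (Ioc_mem_nhdsGT (by norm_num : (0 : ℝ) < 1 / 2))).exists
    exact ⟨δ, h0.1, h0.2, h⟩
  obtain ⟨N₀, hN₀⟩ := measure_exists_gridSum_ge_le hL hδ0.le hb hσ hbc hσc hq hκδ hW hX.adapted x
  set C₀ : ℝ≥0∞ := ENNReal.ofReal ((1 + ‖x‖ ^ 2) ^ q) with hC₀
  set l' : ℝ≥0∞ := ENNReal.ofReal (l / 2 ^ q) with hl'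
  let g : ℝ≥0 → Ω → ℝ := fun t ω => Real.exp (-κ * t) * (1 + ‖X t ω‖ ^ 2) ^ q
  let E : ℕ → Set Ω := fun T => {ω | ∃ j ≤ T * 2 ^ T, l < g ((j : ℝ≥0) / 2 ^ T) ω}
  have hEm : Monotone E := by
    rintro T T' hT ω ⟨j, hj, h⟩
    obtain ⟨j', hj', e⟩ := exists_dyadic_eq hT hT hj
    exact ⟨j', hj', by rwa [e]⟩
  have hEb : ∀ T, l' * P (E T) ≤ C₀ := by
    intro T
    have hlim := tendsto_measure_gridSum hbc hX T hδ0
    set B : ℕ → Set Ω := fun N => {ω | ∃ i ≤ T * 2 ^ N,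
      δ < ‖X ((i : ℝ≥0) / 2 ^ N) ω - gridSum D W x X N i ω‖} with hB
    -- `P (B N)` enters twice: once in replacing `X` by the grid sum, once as the error term of the
    -- maximal inequality.
    have hlim2 : Tendsto (fun N => C₀ + l' * P (B N) + l' * P (B N)) atTop (𝓝 C₀) := by
      have h1 : Tendsto (fun N => l' * P (B N)) atTop (𝓝 0) := by
        simpa using ENNReal.Tendsto.const_mul hlim (Or.inr (ENNReal.ofReal_ne_top (r := l / 2 ^ q)))
      simpa using (tendsto_const_nhds.add h1).add h1
    refine ge_of_tendsto hlim2 ?_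
    filter_upwards [eventually_ge_atTop (max N₀ T)] with N hN
    have hNN : N₀ ≤ N := (le_max_left _ _).trans hN
    have hNT : T ≤ N := (le_max_right _ _).trans hN
    set A : Set Ω := {ω | ∃ j ≤ T * 2 ^ N, l' ≤ ENNReal.ofReal (Real.exp (-κ * (j / 2 ^ N)) *
        (1 + ‖gridSum D W x X N j ω‖ ^ 2) ^ q)} with hA
    have hsub : E T ⊆ A ∪ B N := by
      rintro ω ⟨j, hj, h⟩
      obtain ⟨i, hi, e⟩ := exists_dyadic_eq le_rfl hNT hj
      rw [← e] at h
      by_cases hbad : δ < ‖X ((i : ℝ≥0) / 2 ^ N) ω - gridSum D W x X N i ω‖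
      · exact Or.inr ⟨i, hi, hbad⟩
      · refine Or.inl ⟨i, hi, ENNReal.ofReal_le_ofReal ?_⟩
        rw [div_le_iff₀ (by positivity)]
        refine h.le.trans ?_
        have hy := norm_nonneg (gridSum D W x X N i ω)
        have hx := norm_nonneg (X ((i : ℝ≥0) / 2 ^ N) ω)
        have hn : ‖X ((i : ℝ≥0) / 2 ^ N) ω‖ ≤ ‖gridSum D W x X N i ω‖ + 1 / 2 := by
          have := norm_sub_norm_le (X ((i : ℝ≥0) / 2 ^ N) ω) (gridSum D W x X N i ω)
          linarith [not_lt.1 hbad]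
        have h2 : 1 + ‖X ((i : ℝ≥0) / 2 ^ N) ω‖ ^ 2 ≤
            (1 + ‖gridSum D W x X N i ω‖ ^ 2) * 2 := by
          nlinarith [sq_nonneg (‖gridSum D W x X N i ω‖ - 1 / 2)]
        calc g ((i : ℝ≥0) / 2 ^ N) ω
            = Real.exp (-κ * (i / 2 ^ N)) * (1 + ‖X ((i : ℝ≥0) / 2 ^ N) ω‖ ^ 2) ^ q := by
              simp [g]
          _ ≤ Real.exp (-κ * (i / 2 ^ N)) * ((1 + ‖gridSum D W x X N i ω‖ ^ 2) * 2) ^ q := by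
              gcongr
          _ = _ := by rw [mul_pow]; ring
    calc l' * P (E T) ≤ l' * (P A + P (B N)) := by
          gcongr
          exact (measure_mono hsub).trans (measure_union_le _ _)
      _ = l' * P A + l' * P (B N) := mul_add _ _ _
      _ ≤ _ := by
          gcongr
          refine (hN₀ N hNN l' (T * 2 ^ N)).trans ?_
          gcongr
          rintro ω ⟨i, hi, h⟩
          exact ⟨i, hi.le, h⟩
  have hsup : P {ω | ∃ t : ℝ≥0, l < g t ω} ≤ ⨆ T, P (E T) := by
    rw [← hEm.measure_iUnion]
    refine measure_mono_ae ?_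
    filter_upwards [hX.continuous] with ω hω ⟨t, ht⟩
    have hgc : Continuous fun t => g t ω := by
      have : Continuous fun t : ℝ≥0 => (t : ℝ) := NNReal.continuous_coe
      fun_prop
    obtain ⟨N, j, hj, h⟩ := exists_dyadic_mem (isOpen_lt continuous_const hgc) ht
    exact Set.mem_iUnion.2 ⟨N, j, hj, h⟩
  have hfin : l' * P {ω | ∃ t : ℝ≥0, l < g t ω} ≤ C₀ := by
    refine (mul_le_mul_right hsup l').trans ?_
    rw [ENNReal.mul_iSup]
    exact iSup_le hEb
  have e : ENNReal.ofReal l = ENNReal.ofReal (2 ^ q) * l' := by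
    rw [hl', ← ENNReal.ofReal_mul (by positivity)]
    congr 1
    field_simp
  rw [e, mul_assoc, ENNReal.ofReal_mul (by positivity)]
  exact mul_le_mul_right hfin _

/-- This is where the lower bound on `D.ρ` enters. The constant is `Z = 2K U^θ`, with `U` the
supremum of `e^{-κt}(1+|X_t|²)^q`, and the rate is `κθ`. -/
theorem IsSolution.exists_integrable_bound {D : Data n m} (hD : D.Standing)
    (hW : IsBrownianMotion W P) {x : EuclideanSpace ℝ (Fin n)}
    {X : ℝ≥0 → Ω → EuclideanSpace ℝ (Fin n)} (hX : IsSolution D (brownianFiltration hW) W P x X) :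
    ∃ (Z : Ω → ℝ) (r : ℝ), Integrable Z P ∧ r < D.ρ ∧
      ∀ᵐ ω ∂P, ∀ t : ℝ≥0, |D.π (X t ω)| ≤ Z ω * Real.exp (r * t) ∧
        |D.G (X t ω)| ≤ Z ω * Real.exp (r * t) := by
  obtain ⟨L, p, K, hL, hp, hK, hb, hbL, hσ, hσL, hπ, hG, hρ⟩ := hD.bounds
  have hbc := continuous_of_norm_le hbL
  have hσc := continuous_of_frob_le hσL
  -- The power must be an integer for the Taylor step. `q ≤ p` keeps the rate `aθ = p(3L/2 +
  -- (2q-1)L²)` below `D.ρ`, while `p < q + 1 ≤ 2q` gives `θ < 1`.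
  set q : ℕ := ⌊p⌋₊ with hqdef
  have hqp : (q : ℝ) ≤ p := Nat.floor_le (by linarith)
  have hpq : p < q + 1 := Nat.lt_floor_add_one p
  have hq2 : 2 ≤ q := Nat.le_floor (by exact_mod_cast hp)
  have hq2r : (2 : ℝ) ≤ q := by exact_mod_cast hq2
  have hq1 : 1 ≤ q := by omega
  set θ : ℝ := p / (2 * q) with hθ
  have hθ0 : 0 < θ := by positivity
  have hθ1 : θ < 1 := by rw [hθ, div_lt_one (by positivity)]; linarith
  set a : ℝ := q * (3 * L) + (2 * q ^ 2 - q) * (2 * L ^ 2) with ha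
  have haθ : a * θ < D.ρ := by
    have : a * θ = p * (3 / 2 * L + (2 * q - 1) * L ^ 2) := by
      rw [ha, hθ]; field_simp
    rw [this]
    refine lt_of_le_of_lt ?_ hρ
    gcongr
  obtain ⟨κ, hκ1, hκ2⟩ : ∃ κ, a < κ ∧ κ < D.ρ / θ :=
    exists_between (by rwa [lt_div_iff₀ hθ0])
  rw [lt_div_iff₀ hθ0] at hκ2
  let g : ℝ≥0 → Ω → ℝ := fun t ω => Real.exp (-κ * t) * (1 + ‖X t ω‖ ^ 2) ^ q
  -- A countable supremum over dyadic times, hence measurable; by continuity it almost surely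
  -- dominates all times.
  let U : Ω → ℝ≥0∞ := fun ω => ⨆ N : ℕ, ⨆ j : ℕ, ENNReal.ofReal (g ((j : ℝ≥0) / 2 ^ N) ω)
  have hXm : ∀ t, Measurable (X t) := fun t =>
    (hX.adapted t).mono ((brownianFiltration hW).le t) le_rfl
  have hU : Measurable U := by
    refine Measurable.iSup fun N => Measurable.iSup fun j => Measurable.ennreal_ofReal ?_
    exact (((hXm _).norm.pow_const 2).const_add 1 |>.pow_const q).const_mul _
  have hweak : ∀ l : ℝ, 0 < l → ENNReal.ofReal l * P {ω | ENNReal.ofReal l < U ω} ≤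
      ENNReal.ofReal (2 ^ q * (1 + ‖x‖ ^ 2) ^ q) := by
    intro l hl
    refine le_trans ?_ (mul_measure_exists_gt_le hL hb hσ hbc hσc hq1 hκ1 hW hX hl)
    gcongr with ω
    intro hω
    obtain ⟨N, hN⟩ := lt_iSup_iff.1 hω
    obtain ⟨j, hj⟩ := lt_iSup_iff.1 hN
    exact ⟨_, (ENNReal.ofReal_lt_ofReal_iff_of_nonneg hl.le).1 hj⟩
  refine ⟨fun ω => 2 * K * (U ω).toReal ^ θ, κ * θ,
    (integrable_rpow_of_weak_bound hU (by positivity) hweak hθ0 hθ1).const_mul _, hκ2, ?_⟩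
  filter_upwards [ae_lt_top_of_weak_bound hweak, hX.continuous] with ω hUω hω t
  -- Almost sure finiteness of `U` is essential here, since `toReal` sends `∞` to `0`.
  have hgU : g t ω ≤ (U ω).toReal := by
    by_contra hcon
    have hgc : Continuous fun t => g t ω := by
      have : Continuous fun t : ℝ≥0 => (t : ℝ) := NNReal.continuous_coe
      fun_prop
    obtain ⟨N, j, -, h⟩ := exists_dyadic_mem (isOpen_lt continuous_const hgc) (not_le.1 hcon)
    have h1 : ENNReal.ofReal (g ((j : ℝ≥0) / 2 ^ N) ω) ≤ U ω :=
      le_iSup₂_of_le (f := fun N j => ENNReal.ofReal (g (((j : ℕ) : ℝ≥0) / 2 ^ N) ω)) N j le_rfl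
    have h2 := (ENNReal.ofReal_le_iff_le_toReal hUω.ne).1 h1
    exact absurd h (not_lt.2 h2)
  have hS : (1 : ℝ) ≤ 1 + ‖X t ω‖ ^ 2 := by nlinarith [sq_nonneg ‖X t ω‖]
  have hS0 : (0 : ℝ) ≤ 1 + ‖X t ω‖ ^ 2 := by linarith
  have hSU : (1 + ‖X t ω‖ ^ 2) ^ q ≤ (U ω).toReal * Real.exp (κ * t) := by
    have : (1 + ‖X t ω‖ ^ 2) ^ q = g t ω * Real.exp (κ * t) := by
      simp only [g]
      rw [mul_right_comm, ← Real.exp_add]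
      simp
    rw [this]
    gcongr
  have hSp : (1 + ‖X t ω‖ ^ 2) ^ (p / 2) ≤ (U ω).toReal ^ θ * Real.exp (κ * θ * t) := by
    calc (1 + ‖X t ω‖ ^ 2) ^ (p / 2) = ((1 + ‖X t ω‖ ^ 2) ^ q) ^ θ := by
          rw [← Real.rpow_natCast (1 + ‖X t ω‖ ^ 2) q, ← Real.rpow_mul hS0]
          congr 1
          rw [hθ]; field_simp
      _ ≤ ((U ω).toReal * Real.exp (κ * t)) ^ θ := by gcongr
      _ = _ := by
          rw [Real.mul_rpow ENNReal.toReal_nonneg (Real.exp_nonneg _), ← Real.exp_mul]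
          congr 2
          ring
  have hXp : 1 + ‖X t ω‖ ^ p ≤ 2 * (1 + ‖X t ω‖ ^ 2) ^ (p / 2) := by
    have h1 : (1 : ℝ) ≤ (1 + ‖X t ω‖ ^ 2) ^ (p / 2) := Real.one_le_rpow hS (by linarith)
    have h2 : ‖X t ω‖ ^ p ≤ (1 + ‖X t ω‖ ^ 2) ^ (p / 2) := by
      calc ‖X t ω‖ ^ p = (‖X t ω‖ ^ 2) ^ (p / 2) := by
            rw [← Real.rpow_natCast, ← Real.rpow_mul (norm_nonneg _)]
            congr 1
            push_cast; ring
        _ ≤ _ := by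
            refine Real.rpow_le_rpow (sq_nonneg _) (by linarith) (by linarith)
    linarith
  have hfin : K * (1 + ‖X t ω‖ ^ p) ≤ 2 * K * (U ω).toReal ^ θ * Real.exp (κ * θ * t) := by
    calc K * (1 + ‖X t ω‖ ^ p) ≤ K * (2 * ((U ω).toReal ^ θ * Real.exp (κ * θ * t))) := by
          gcongr
          exact hXp.trans (by gcongr)
      _ = _ := by ring
  exact ⟨(hπ _).trans hfin, (hG _).trans hfin⟩

end Moment

end EntropyOS

/-! ### Bounds and measurability of the payoff along a dominated path. -/

namespace EntropyOS

section Paths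

variable {Ω : Type*} {mΩ : MeasurableSpace Ω} {n m : ℕ}

/-- The payoff along a path when stopping at time `T`. -/
noncomputable def pathPayoff (D : Data n m) (φ : ℝ≥0 → EuclideanSpace ℝ (Fin n))
    (T : WithTop ℝ≥0) : ℝ :=
  (∫ s in {s : ℝ | 0 ≤ s ∧ (s.toNNReal : WithTop ℝ≥0) ≤ T},
      Real.exp (-D.ρ * s) * D.π (φ s.toNNReal)) +
    match T with
    | ⊤ => 0
    | (t : ℝ≥0) => Real.exp (-D.ρ * t) * D.G (φ t)

/-- A continuous path along which the discounted profits decay exponentially. -/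
structure DominatedPath (D : Data n m) (φ : ℝ≥0 → EuclideanSpace ℝ (Fin n)) (z c : ℝ) : Prop where
  pos : 0 < c
  continuous : Continuous φ
  continuous_π : Continuous D.π
  continuous_G : Continuous D.G
  le_π : ∀ t : ℝ≥0, |D.π (φ t)| ≤ z * Real.exp ((D.ρ - c) * t)
  le_G : ∀ t : ℝ≥0, |D.G (φ t)| ≤ z * Real.exp ((D.ρ - c) * t)

theorem integrableOn_Ici_exp_neg {c : ℝ} (hc : 0 < c) :
    IntegrableOn (fun s : ℝ => Real.exp (-c * s)) (Set.Ici 0) :=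
  integrableOn_Ici_iff_integrableOn_Ioi (by finiteness) |>.2 (exp_neg_integrableOn_Ioi 0 hc)

namespace DominatedPath

variable {D : Data n m} {φ : ℝ≥0 → EuclideanSpace ℝ (Fin n)} {z c : ℝ}

theorem nonneg (h : DominatedPath D φ z c) : 0 ≤ z := by
  simpa using (abs_nonneg _).trans (h.le_π 0)

theorem abs_mul_le {a ρ z c t : ℝ} (h : |a| ≤ z * Real.exp ((ρ - c) * t)) :
    |Real.exp (-ρ * t) * a| ≤ z * Real.exp (-c * t) := by
  rw [abs_mul, abs_of_pos (Real.exp_pos _)]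
  calc Real.exp (-ρ * t) * |a| ≤ Real.exp (-ρ * t) * (z * Real.exp ((ρ - c) * t)) := by gcongr
    _ = z * (Real.exp (-ρ * t) * Real.exp ((ρ - c) * t)) := by ring
    _ = _ := by rw [← Real.exp_add]; congr 2; ring

theorem abs_running_le (h : DominatedPath D φ z c) {s : ℝ} (hs : 0 ≤ s) :
    |Real.exp (-D.ρ * s) * D.π (φ s.toNNReal)| ≤ z * Real.exp (-c * s) := by
  have := h.le_π s.toNNReal
  rw [Real.coe_toNNReal _ hs] at this
  exact abs_mul_le this

theorem abs_terminal_le (h : DominatedPath D φ z c) (t : ℝ≥0) :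
    |Real.exp (-D.ρ * t) * D.G (φ t)| ≤ z := by
  refine (abs_mul_le (h.le_G t)).trans ?_
  refine mul_le_of_le_one_right h.nonneg (Real.exp_le_one_iff.2 ?_)
  have := mul_nonneg h.pos.le t.coe_nonneg
  linarith

theorem continuous_running (h : DominatedPath D φ z c) :
    Continuous fun s : ℝ => Real.exp (-D.ρ * s) * D.π (φ s.toNNReal) := by
  have := h.continuous_π.comp (h.continuous.comp continuous_real_toNNReal)
  exact (by fun_prop : Continuous fun s : ℝ => Real.exp (-D.ρ * s)).mul this

theorem continuous_terminal (h : DominatedPath D φ z c) :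
    Continuous fun s : ℝ => Real.exp (-D.ρ * s) * D.G (φ s.toNNReal) := by
  have := h.continuous_G.comp (h.continuous.comp continuous_real_toNNReal)
  exact (by fun_prop : Continuous fun s : ℝ => Real.exp (-D.ρ * s)).mul this

theorem integrableOn_running (h : DominatedPath D φ z c) :
    IntegrableOn (fun s : ℝ => Real.exp (-D.ρ * s) * D.π (φ s.toNNReal)) (Set.Ici 0) := by
  have hi : IntegrableOn (fun s : ℝ => z * Real.exp (-c * s)) (Set.Ici 0) :=
    (integrableOn_Ici_exp_neg h.pos).const_mul z
  refine Integrable.mono' hi h.continuous_running.aestronglyMeasurable ?_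
  refine (ae_restrict_iff' measurableSet_Ici).2 (Eventually.of_forall fun s hs => ?_)
  exact h.abs_running_le hs

theorem integrableOn_terminal (h : DominatedPath D φ z c) (μ : Measure ℝ) [IsFiniteMeasure μ] :
    IntegrableOn (fun s : ℝ => Real.exp (-D.ρ * s) * D.G (φ s.toNNReal)) (Set.Ici 0) μ := by
  refine Integrable.mono' (integrable_const z) h.continuous_terminal.aestronglyMeasurable ?_
  refine (ae_restrict_iff' measurableSet_Ici).2 (Eventually.of_forall fun s hs => ?_)
  have := h.abs_terminal_le s.toNNReal
  rwa [Real.coe_toNNReal _ hs] at this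

theorem abs_pathPayoff_le (h : DominatedPath D φ z c) (T : WithTop ℝ≥0) :
    |pathPayoff D φ T| ≤ (c⁻¹ + 1) * z := by
  have hz := h.nonneg
  have hi : IntegrableOn (fun s : ℝ => z * Real.exp (-c * s)) (Set.Ici 0) :=
    (integrableOn_Ici_exp_neg h.pos).const_mul z
  have hsub : {s : ℝ | 0 ≤ s ∧ (s.toNNReal : WithTop ℝ≥0) ≤ T} ⊆ Set.Ici 0 := fun s hs => hs.1
  have hSm : MeasurableSet {s : ℝ | 0 ≤ s ∧ (s.toNNReal : WithTop ℝ≥0) ≤ T} := by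
    refine measurableSet_Ici.inter ?_
    exact (measurable_real_toNNReal.withTop_coe) measurableSet_Iic
  have h1 : |∫ s in {s : ℝ | 0 ≤ s ∧ (s.toNNReal : WithTop ℝ≥0) ≤ T},
      Real.exp (-D.ρ * s) * D.π (φ s.toNNReal)| ≤ c⁻¹ * z := by
    calc _ ≤ ∫ s in {s : ℝ | 0 ≤ s ∧ (s.toNNReal : WithTop ℝ≥0) ≤ T}, z * Real.exp (-c * s) := by
          rw [← Real.norm_eq_abs]
          refine norm_integral_le_of_norm_le (hi.mono_set hsub) ?_
          exact (ae_restrict_iff' hSm).2 (Eventually.of_forall fun s hs => h.abs_running_le hs.1)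
      _ ≤ ∫ s in Set.Ici (0 : ℝ), z * Real.exp (-c * s) :=
          setIntegral_mono_set hi (Eventually.of_forall fun s => by positivity)
            hsub.eventuallyLE
      _ = c⁻¹ * z := by
          rw [integral_const_mul, integral_Ici_eq_integral_Ioi,
            integral_exp_mul_Ioi (by linarith [h.pos])]
          simp
          ring
  refine (abs_add_le _ _).trans ?_
  rw [add_mul, one_mul]
  refine add_le_add h1 ?_
  rcases T with _ | t
  · simpa using hz
  · exact h.abs_terminal_le t

end DominatedPath

theorem match_top_eq_ite (f : ℝ≥0 → ℝ) (T : WithTop ℝ≥0) [Decidable (T = ⊤)] :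
    (match T with
      | ⊤ => 0
      | (t : ℝ≥0) => f t) = if T = ⊤ then 0 else f (T.untopD 0) := by
  rcases T with _ | t
  · exact (if_pos rfl).symm
  · exact (if_neg (WithTop.coe_ne_top)).symm

/-- The parameter space `α` is left free to cover both a stopping time on `Ω` and the level times on
`Ω × ℝ`. -/
theorem measurable_pathPayoff {D : Data n m} (hπ : Continuous D.π) (hG : Continuous D.G)
    {X : ℝ≥0 → Ω → EuclideanSpace ℝ (Fin n)} (hX : Measurable (Function.uncurry X)) {α : Type*}
    {mα : MeasurableSpace α} {w : α → Ω} (hw : Measurable w) {T : α → WithTop ℝ≥0}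
    (hT : Measurable T) : Measurable fun a => pathPayoff D (X · (w a)) (T a) := by
  have hpairs : Measurable fun p : α × ℝ => X p.2.toNNReal (w p.1) :=
    hX.comp ((measurable_real_toNNReal.comp measurable_snd).prodMk (hw.comp measurable_fst))
  refine Measurable.add ?_ ?_
  · have hS : MeasurableSet {p : α × ℝ | 0 ≤ p.2 ∧ (p.2.toNNReal : WithTop ℝ≥0) ≤ T p.1} := by
      refine (measurable_snd measurableSet_Ici).inter ?_
      exact measurableSet_le ((measurable_real_toNNReal.comp measurable_snd).withTop_coe)
        (hT.comp measurable_fst)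
    have hf : Measurable fun p : α × ℝ => Real.exp (-D.ρ * p.2) * D.π (X p.2.toNNReal (w p.1)) :=
      (by fun_prop : Measurable fun p : α × ℝ => Real.exp (-D.ρ * p.2)).mul
        (hπ.measurable.comp hpairs)
    have hm := ((hf.indicator hS).stronglyMeasurable.integral_prod_right' (ν := volume)).measurable
    convert hm using 2 with a
    exact (integral_indicator
      (f := fun s : ℝ => Real.exp (-D.ρ * s) * D.π (X s.toNNReal (w a)))
      (measurable_prodMk_left (x := a) hS)).symm
  · have hlt : MeasurableSet {a | T a = ⊤} := hT (measurableSet_singleton ⊤)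
    have hg : Measurable fun a => Real.exp (-D.ρ * ((T a).untopD 0 : ℝ≥0)) *
        D.G (X ((T a).untopD 0) (w a)) := by
      have hu : Measurable fun a => (T a).untopD 0 := hT.untopD 0
      refine Measurable.mul ?_ (hG.measurable.comp (hX.comp (hu.prodMk hw)))
      exact (Real.measurable_exp.comp ((measurable_coe_nnreal_real.comp hu).const_mul _))
    classical
    convert Measurable.ite hlt (measurable_const (a := (0 : ℝ))) hg using 2 with a
    exact match_top_eq_ite (fun t => Real.exp (-D.ρ * t) * D.G (X t (w a))) (T a)

end Paths

end EntropyOS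

/-! ### Level times: a singular control as an average of stopping times. -/

namespace EntropyOS

namespace SingularControl

variable {Ω : Type*} {mΩ : MeasurableSpace Ω} {𝔽 : Filtration ℝ≥0 mΩ} {n m : ℕ}

open Classical in
/-- The first time at which the control reaches the level `u`. -/
noncomputable def levelTime (ξ : SingularControl 𝔽) (u : ℝ) (ω : Ω) : WithTop ℝ≥0 :=
  if ∃ t, u ≤ ξ.toFun t ω then ((sInf {t | u ≤ ξ.toFun t ω} : ℝ≥0) : WithTop ℝ≥0) else ⊤

/-- Right continuity makes the infimum attained. This equivalence yields the stopping-time property,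
all measurability statements and both changes of variables below. -/
theorem levelTime_le_iff (ξ : SingularControl 𝔽) {u : ℝ} {ω : Ω} {t : ℝ≥0} :
    ξ.levelTime u ω ≤ t ↔ u ≤ ξ.toFun t ω := by
  unfold levelTime
  split_ifs with h
  · rw [WithTop.coe_le_coe]
    refine ⟨fun ht => ?_, fun ht => csInf_le (OrderBot.bddBelow _) ht⟩
    refine le_trans ?_ (ξ.mono ω ht)
    set a := sInf {t | u ≤ ξ.toFun t ω} with ha
    have hlim : Tendsto (fun s => ξ.toFun s ω) (𝓝[>] a) (𝓝 (ξ.toFun a ω)) :=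
      (ξ.rightCont ω a).mono_left (nhdsWithin_mono _ Set.Ioi_subset_Ici_self)
    refine ge_of_tendsto hlim (eventually_nhdsWithin_of_forall fun s hs => ?_)
    obtain ⟨r, hr, hrs⟩ := exists_lt_of_csInf_lt h hs
    exact le_trans hr (ξ.mono ω hrs.le)
  · simp only [top_le_iff, WithTop.coe_ne_top, false_iff]
    exact fun ht => h ⟨t, ht⟩

theorem isStoppingTime_levelTime (ξ : SingularControl 𝔽) (u : ℝ) :
    IsStoppingTime 𝔽 (ξ.levelTime u) := by
  intro t
  simp_rw [levelTime_le_iff]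
  exact ξ.adapted t measurableSet_Ici

theorem measurable_of_le_coe {α : Type*} {mα : MeasurableSpace α} {T : α → WithTop ℝ≥0}
    (h : ∀ t : ℝ≥0, MeasurableSet {a | T a ≤ t}) : Measurable T := by
  refine measurable_of_Iic fun x => ?_
  rcases x with _ | t
  · have : T ⁻¹' Set.Iic (none : WithTop ℝ≥0) = Set.univ :=
      Set.eq_univ_of_forall fun a => (le_top : T a ≤ ⊤)
    rw [this]
    exact MeasurableSet.univ
  · exact h t

theorem measurable_levelTime (ξ : SingularControl 𝔽) :
    Measurable fun p : Ω × ℝ => ξ.levelTime p.2 p.1 := by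
  refine measurable_of_le_coe fun t => ?_
  simp_rw [levelTime_le_iff]
  exact measurableSet_le measurable_snd (((ξ.adapted t).mono (𝔽.le t) le_rfl).comp measurable_fst)

/-- The equivalence is read backwards: for a fixed level, `u ≤ ξ_t` compares the measurable time
`τ_u` with the variable `t`. -/
theorem measurable_uncurry (ξ : SingularControl 𝔽) :
    Measurable fun p : Ω × ℝ => ξ.toFun p.2.toNNReal p.1 := by
  refine measurable_of_Ici fun u => ?_
  have e : (fun p : Ω × ℝ => ξ.toFun p.2.toNNReal p.1) ⁻¹' Set.Ici u =
      {p : Ω × ℝ | ξ.levelTime u p.1 ≤ (p.2.toNNReal : WithTop ℝ≥0)} := by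
    ext p
    exact ξ.levelTime_le_iff.symm
  rw [e]
  refine measurableSet_le ?_ (measurable_real_toNNReal.comp measurable_snd).withTop_coe
  exact ξ.measurable_levelTime.comp (measurable_fst.prodMk measurable_const)

theorem measurable_levelTime_left (ξ : SingularControl 𝔽) (ω : Ω) :
    Measurable fun u : ℝ => ξ.levelTime u ω :=
  ξ.measurable_levelTime.comp (measurable_const.prodMk measurable_id)

theorem measurable_path (ξ : SingularControl 𝔽) (ω : Ω) :
    Measurable fun t : ℝ => ξ.toFun t.toNNReal ω :=
  ξ.measurable_uncurry.comp (measurable_const.prodMk measurable_id)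

theorem measurableSet_levelTime_ne_top (ξ : SingularControl 𝔽) (ω : Ω) :
    MeasurableSet {u : ℝ | ξ.levelTime u ω ≠ ⊤} :=
  (ξ.measurable_levelTime_left ω) (measurableSet_singleton ⊤).compl

/-- The quantile transform: the levels `u` in `(0,1]` with `τ_u ≤ a` form the interval `(0, ξ_a]`,
whose length is the `dξ`-mass up to `a`. Levels that are never reached are removed, as `untopD 0`
would otherwise place their mass at time `0`. -/
theorem dmeasure_eq_map (ξ : SingularControl 𝔽) (ω : Ω) :
    ξ.dmeasure ω = (volume.restrict (Set.Ioc 0 1 ∩ {u : ℝ | ξ.levelTime u ω ≠ ⊤})).map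
      (fun u => (((ξ.levelTime u ω).untopD 0 : ℝ≥0) : ℝ)) := by
  have hm : Measurable fun u : ℝ => (((ξ.levelTime u ω).untopD 0 : ℝ≥0) : ℝ) :=
    measurable_coe_nnreal_real.comp ((ξ.measurable_levelTime_left ω).untopD 0)
  have hfin : IsFiniteMeasure ((volume.restrict (Set.Ioc 0 1 ∩
      {u : ℝ | ξ.levelTime u ω ≠ ⊤})).map
      (fun u => (((ξ.levelTime u ω).untopD 0 : ℝ≥0) : ℝ))) := by
    have : IsFiniteMeasure (volume.restrict (Set.Ioc 0 1 ∩ {u : ℝ | ξ.levelTime u ω ≠ ⊤})) :=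
      ⟨by
        rw [Measure.restrict_apply_univ]
        exact (measure_mono Set.inter_subset_left).trans_lt measure_Ioc_lt_top⟩
    infer_instance
  refine (Measure.ext_of_Iic _ _ fun a => ?_).symm
  have hbot : Tendsto (ξ.stieltjes ω) atBot (𝓝 0) := by
    refine tendsto_const_nhds.congr' ?_
    filter_upwards [eventually_lt_atBot (0 : ℝ)] with t ht
    exact (if_neg (not_le.2 ht)).symm
  rw [dmeasure, StieltjesFunction.measure_Iic _ hbot, sub_zero, Measure.map_apply hm
    measurableSet_Iic, Measure.restrict_apply (hm measurableSet_Iic)]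
  by_cases ha : 0 ≤ a
  · have e1 : ξ.stieltjes ω a = ξ.toFun a.toNNReal ω := if_pos ha
    have e2 : (fun u => (((ξ.levelTime u ω).untopD 0 : ℝ≥0) : ℝ)) ⁻¹' Set.Iic a ∩
        (Set.Ioc 0 1 ∩ {u : ℝ | ξ.levelTime u ω ≠ ⊤}) = Set.Ioc 0 (ξ.toFun a.toNNReal ω) := by
      ext u
      simp only [Set.mem_inter_iff, Set.mem_preimage, Set.mem_Iic, Set.mem_Ioc, Set.mem_ofPred_eq]
      constructor
      · rintro ⟨h1, ⟨h2, -⟩, h3⟩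
        refine ⟨h2, ξ.levelTime_le_iff.1 ?_⟩
        obtain ⟨t, ht⟩ := WithTop.ne_top_iff_exists.1 h3
        rw [← ht, WithTop.coe_le_coe]
        rw [← ht] at h1
        exact NNReal.le_toNNReal_of_coe_le h1
      · rintro ⟨h1, h2⟩
        have h3 := ξ.levelTime_le_iff.2 h2
        have h4 : ξ.levelTime u ω ≠ ⊤ := ne_top_of_le_ne_top WithTop.coe_ne_top h3
        refine ⟨?_, ⟨h1, h2.trans (ξ.mem_Icc _ _).2⟩, h4⟩
        obtain ⟨t, ht⟩ := WithTop.ne_top_iff_exists.1 h4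
        rw [← ht, WithTop.coe_le_coe] at h3
        rw [← ht]
        exact (Real.le_toNNReal_iff_coe_le ha).1 h3
    rw [e1, e2, Real.volume_Ioc, sub_zero]
  · have e1 : ξ.stieltjes ω a = 0 := if_neg ha
    have e2 : (fun u => (((ξ.levelTime u ω).untopD 0 : ℝ≥0) : ℝ)) ⁻¹' Set.Iic a = ∅ := by
      ext u
      simp only [Set.mem_preimage, Set.mem_Iic, Set.mem_empty_iff_false, iff_false]
      exact fun h => ha (NNReal.coe_nonneg _ |>.trans h)
    rw [e1, e2]
    simp

instance isFiniteMeasure_dmeasure (ξ : SingularControl 𝔽) (ω : Ω) :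
    IsFiniteMeasure (ξ.dmeasure ω) := by
  rw [dmeasure_eq_map]
  have : IsFiniteMeasure (volume.restrict (Set.Ioc 0 1 ∩ {u : ℝ | ξ.levelTime u ω ≠ ⊤})) :=
    ⟨by
      rw [Measure.restrict_apply_univ]
      exact (measure_mono Set.inter_subset_left).trans_lt measure_Ioc_lt_top⟩
  infer_instance

variable {D : Data n m} {X : ℝ≥0 → Ω → EuclideanSpace ℝ (Fin n)} {z c : ℝ}

theorem terminal_eq_integral (ξ : SingularControl 𝔽) {ω : Ω} (h : DominatedPath D (X · ω) z c) :
    Integrable (fun u => match ξ.levelTime u ω with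
      | ⊤ => 0
      | (t : ℝ≥0) => Real.exp (-D.ρ * t) * D.G (X t ω)) (volume.restrict (Set.Ioc 0 1)) ∧
    ∫ t in Set.Ici (0 : ℝ), Real.exp (-D.ρ * t) * D.G (X t.toNNReal ω) ∂(ξ.dmeasure ω) =
      ∫ u in Set.Ioc (0 : ℝ) 1, match ξ.levelTime u ω with
      | ⊤ => 0
      | (t : ℝ≥0) => Real.exp (-D.ρ * t) * D.G (X t ω) := by
  set g : ℝ → ℝ := fun t => Real.exp (-D.ρ * t) * D.G (X t.toNNReal ω) with hg
  set S : Set ℝ := {u : ℝ | ξ.levelTime u ω ≠ ⊤} with hS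
  have hSm : MeasurableSet S := ξ.measurableSet_levelTime_ne_top ω
  have hm : Measurable fun u : ℝ => (((ξ.levelTime u ω).untopD 0 : ℝ≥0) : ℝ) :=
    measurable_coe_nnreal_real.comp ((ξ.measurable_levelTime_left ω).untopD 0)
  have e : (fun u => match ξ.levelTime u ω with
      | ⊤ => 0
      | (t : ℝ≥0) => Real.exp (-D.ρ * t) * D.G (X t ω)) =
      S.indicator fun u => g (((ξ.levelTime u ω).untopD 0 : ℝ≥0) : ℝ) := by
    classical
    funext u
    rw [Set.indicator_apply]
    refine (match_top_eq_ite (fun t => Real.exp (-D.ρ * t) * D.G (X t ω)) _).trans ?_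
    by_cases hu : ξ.levelTime u ω = ⊤ <;> simp [hu, S, g]
  have hgc : Continuous g := h.continuous_terminal
  have hint := h.integrableOn_terminal (ξ.dmeasure ω)
  have hpre : (fun u : ℝ => (((ξ.levelTime u ω).untopD 0 : ℝ≥0) : ℝ)) ⁻¹' Set.Ici 0 = Set.univ :=
    Set.eq_univ_of_forall fun u => NNReal.coe_nonneg _
  have hmeq := ξ.dmeasure_eq_map ω
  constructor
  · rw [e, integrable_indicator_iff hSm, IntegrableOn, Measure.restrict_restrict hSm,
      Set.inter_comm]
    rw [hmeq, IntegrableOn, Measure.restrict_map hm measurableSet_Ici, hpre,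
      Measure.restrict_univ] at hint
    exact (integrable_map_measure hgc.aestronglyMeasurable hm.aemeasurable).1 hint
  · rw [e, integral_indicator hSm, Measure.restrict_restrict hSm, hmeq,
      setIntegral_map measurableSet_Ici hgc.aestronglyMeasurable hm.aemeasurable, hpre,
      Measure.restrict_univ, Set.inter_comm]

/-- `1 - ξ_t` is the length of the set of levels `u` in `(ξ_t, 1]`; Fubini exchanges the level and
the time. -/
theorem running_eq_integral (ξ : SingularControl 𝔽) {ω : Ω} (h : DominatedPath D (X · ω) z c) :
    Integrable (fun u => ∫ s in {s : ℝ | 0 ≤ s ∧ (s.toNNReal : WithTop ℝ≥0) ≤ ξ.levelTime u ω},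
      Real.exp (-D.ρ * s) * D.π (X s.toNNReal ω)) (volume.restrict (Set.Ioc 0 1)) ∧
    ∫ t in Set.Ici (0 : ℝ), Real.exp (-D.ρ * t) * (D.π (X t.toNNReal ω) *
        (1 - ξ.toFun t.toNNReal ω)) =
      ∫ u in Set.Ioc (0 : ℝ) 1, ∫ s in {s : ℝ | 0 ≤ s ∧ (s.toNNReal : WithTop ℝ≥0) ≤
        ξ.levelTime u ω}, Real.exp (-D.ρ * s) * D.π (X s.toNNReal ω) := by
  set f : ℝ → ℝ := fun t => Real.exp (-D.ρ * t) * D.π (X t.toNNReal ω) with hf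
  have hfi : Integrable f (volume.restrict (Set.Ici 0)) := h.integrableOn_running
  set A : Set (ℝ × ℝ) := {p | ξ.toFun p.1.toNNReal ω < p.2} with hA
  have hAm : MeasurableSet A :=
    measurableSet_lt ((ξ.measurable_path ω).comp measurable_fst) measurable_snd
  set F : ℝ × ℝ → ℝ := A.indicator fun p => f p.1 with hF
  have hFi : Integrable F ((volume.restrict (Set.Ici 0)).prod (volume.restrict (Set.Ioc 0 1))) :=
    (hfi.comp_fst _).indicator hAm
  have inner1 : ∀ t, ∫ u in Set.Ioc (0 : ℝ) 1, F (t, u) =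
      Real.exp (-D.ρ * t) * (D.π (X t.toNNReal ω) * (1 - ξ.toFun t.toNNReal ω)) := by
    intro t
    have hξ := ξ.mem_Icc t.toNNReal ω
    have e : (fun u => F (t, u)) = (Set.Ioi (ξ.toFun t.toNNReal ω)).indicator fun _ => f t := by
      funext u; simp [F, A, Set.indicator]
    rw [e, integral_indicator measurableSet_Ioi, Measure.restrict_restrict measurableSet_Ioi,
      setIntegral_const, Set.inter_comm, Set.Ioc_inter_Ioi, sup_eq_right.2 hξ.1]
    rw [Real.volume_real_Ioc_of_le hξ.2, smul_eq_mul, hf]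
    ring
  have inner2 : ∀ u, ∫ t in Set.Ici (0 : ℝ), F (t, u) =
      ∫ s in {s : ℝ | 0 ≤ s ∧ (s.toNNReal : WithTop ℝ≥0) ≤ ξ.levelTime u ω}, f s := by
    intro u
    set B : Set ℝ := {t | ξ.toFun t.toNNReal ω < u} with hB
    have hBm : MeasurableSet B := measurableSet_lt (ξ.measurable_path ω) measurable_const
    have e : (fun t => F (t, u)) = B.indicator f := by
      funext t; simp [F, A, B, Set.indicator]
    rw [e, integral_indicator hBm, Measure.restrict_restrict hBm]
    refine setIntegral_congr_set ?_
    -- The condition `ξ_s < u` means `s < τ_u`, whereas the payoff integrates up to and including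
    -- `τ_u`; the two time sets differ at one point at most.
    have hnull : ∀ᵐ s : ℝ, s ≠ (((ξ.levelTime u ω).untopD 0 : ℝ≥0) : ℝ) := by
      simp [ae_iff]
    filter_upwards [hnull] with s hs
    have hBs : s ∈ B ↔ (s.toNNReal : WithTop ℝ≥0) < ξ.levelTime u ω := by
      rw [← not_le, levelTime_le_iff, not_le]; rfl
    refine propext ⟨fun hh => ⟨hh.2, (hBs.1 hh.1).le⟩, fun hh => ⟨hBs.2 ?_, hh.1⟩⟩
    refine lt_of_le_of_ne hh.2 fun heq => hs ?_
    rw [← heq]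
    exact (Real.coe_toNNReal _ hh.1).symm
  have hswap := integral_integral_swap (f := fun t u => F (t, u)) hFi
  simp_rw [inner1, inner2] at hswap
  refine ⟨?_, hswap⟩
  have := hFi.integral_prod_right
  simp_rw [inner2] at this
  exact this

/-- The discounted entropy of a path of the control. -/
noncomputable def entropy (ρ : ℝ) (ξ : SingularControl 𝔽) (ω : Ω) : ℝ :=
  ∫ t in Set.Ici (0 : ℝ), Real.exp (-ρ * t) *
    ((1 - ξ.toFun t.toNNReal ω) * Real.log (1 - ξ.toFun t.toNNReal ω))

theorem controlPayoff_eq (ξ : SingularControl 𝔽) {ω : Ω} (h : DominatedPath D (X · ω) z c)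
    (lam : ℝ) : controlPayoff D X lam ξ ω =
      (∫ u in Set.Ioc (0 : ℝ) 1, pathPayoff D (X · ω) (ξ.levelTime u ω)) -
        lam * ξ.entropy D.ρ ω := by
  unfold controlPayoff
  rw [(ξ.running_eq_integral h).2, (ξ.terminal_eq_integral h).2,
    ← integral_add (ξ.running_eq_integral h).1 (ξ.terminal_eq_integral h).1]
  rfl

theorem abs_mul_log_le {x : ℝ} (h0 : 0 ≤ x) (h1 : x ≤ 1) : |x * Real.log x| ≤ (Real.exp 1)⁻¹ := by
  rcases h0.eq_or_lt with rfl | hx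
  · simp; positivity
  rw [abs_of_nonpos (mul_nonpos_of_nonneg_of_nonpos h0 (Real.log_nonpos h0 h1))]
  have he : 0 < Real.exp 1 := Real.exp_pos 1
  -- The inequality `log y ≤ y - 1` at `y = 1/(ex)`, which is an equality at the maximizer `x =
  -- 1/e`.
  have h2 := Real.log_le_sub_one_of_pos (x := (Real.exp 1 * x)⁻¹) (by positivity)
  rw [Real.log_inv, Real.log_mul he.ne' hx.ne', Real.log_exp] at h2
  have h3 : -Real.log x ≤ (Real.exp 1 * x)⁻¹ := by linarith
  calc -(x * Real.log x) = x * -Real.log x := by ring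
    _ ≤ x * (Real.exp 1 * x)⁻¹ := by gcongr
    _ = (Real.exp 1)⁻¹ := by field_simp

theorem abs_entropy_le {ρ : ℝ} (hρ : 0 < ρ) (ξ : SingularControl 𝔽) (ω : Ω) :
    |ξ.entropy ρ ω| ≤ (ρ * Real.exp 1)⁻¹ := by
  have hi := (integrableOn_Ici_exp_neg hρ).mul_const (Real.exp 1)⁻¹
  unfold entropy
  rw [← Real.norm_eq_abs]
  refine (norm_integral_le_of_norm_le hi (Eventually.of_forall fun t => ?_)).trans_eq ?_
  · have hξ := ξ.mem_Icc t.toNNReal ω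
    rw [norm_mul, Real.norm_of_nonneg (Real.exp_nonneg _), Real.norm_eq_abs]
    gcongr
    exact abs_mul_log_le (by linarith [hξ.2]) (by linarith [hξ.1])
  · rw [integral_mul_const, integral_Ici_eq_integral_Ioi, integral_exp_mul_Ioi (by linarith)]
    simp [mul_comm]

theorem measurable_entropy (ρ : ℝ) (ξ : SingularControl 𝔽) : Measurable (ξ.entropy ρ) := by
  have h1 : Measurable fun p : Ω × ℝ => 1 - ξ.toFun p.2.toNNReal p.1 :=
    measurable_const.sub ξ.measurable_uncurry
  have h2 : Measurable fun p : Ω × ℝ => Real.exp (-ρ * p.2) *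
      ((1 - ξ.toFun p.2.toNNReal p.1) * Real.log (1 - ξ.toFun p.2.toNNReal p.1)) :=
    (by fun_prop : Measurable fun p : Ω × ℝ => Real.exp (-ρ * p.2)).mul (h1.mul h1.log)
  exact (h2.stronglyMeasurable.integral_prod_right'
    (ν := volume.restrict (Set.Ici (0 : ℝ)))).measurable

end SingularControl

end EntropyOS

/-! ### Comparison of the two families of values. -/

namespace EntropyOS

section Values

variable {Ω : Type*} {mΩ : MeasurableSpace Ω} {P : Measure Ω} {𝔽 : Filtration ℝ≥0 mΩ} {n m : ℕ}

theorem eq_of_forall_le_coe_iff {a b : WithTop ℝ≥0} (h : ∀ t : ℝ≥0, a ≤ t ↔ b ≤ t) : a = b := by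
  rcases a with _ | a
  · rcases b with _ | b
    · rfl
    · exact top_le_iff.1 ((h b).2 le_rfl) |>.symm
  · exact le_antisymm (by rcases b with _ | b; exacts [le_top, (h b).2 le_rfl]) ((h a).1 le_rfl)

open Classical in
/-- The control that jumps from `0` to `1` at a stopping time. -/
noncomputable def SingularControl.ofStoppingTime {τ : Ω → WithTop ℝ≥0} (hτ : IsStoppingTime 𝔽 τ) :
    SingularControl 𝔽 where
  toFun t ω := if τ ω ≤ t then 1 else 0
  adapted t := Measurable.ite (hτ t) measurable_const measurable_const
  mem_Icc t ω := by split_ifs <;> simp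
  mono ω s t hst := by
    dsimp only
    split_ifs with h1 h2
    · exact le_rfl
    · exact absurd (h1.trans (WithTop.coe_le_coe.2 hst)) h2
    · exact zero_le_one
    · exact le_rfl
  rightCont ω t := by
    by_cases h : τ ω ≤ t
    · refine (continuousWithinAt_const (b := (1 : ℝ))).congr (fun s hs => ?_) ?_
      · exact if_pos (h.trans (WithTop.coe_le_coe.2 hs))
      · exact if_pos h
    · refine ContinuousAt.continuousWithinAt ((continuousAt_const (y := (0 : ℝ))).congr ?_)
      have hU : {s : ℝ≥0 | (s : WithTop ℝ≥0) < τ ω} ∈ 𝓝 t :=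
        (isOpen_Iio.preimage WithTop.continuous_coe).mem_nhds (not_le.1 h)
      filter_upwards [hU] with s hs
      exact (if_neg (not_le.2 hs)).symm

theorem SingularControl.levelTime_ofStoppingTime {τ : Ω → WithTop ℝ≥0}
    (hτ : IsStoppingTime 𝔽 τ) {u : ℝ} (hu : u ∈ Set.Ioc (0 : ℝ) 1) (ω : Ω) :
    (SingularControl.ofStoppingTime hτ).levelTime u ω = τ ω := by
  refine eq_of_forall_le_coe_iff fun t => ?_
  rw [SingularControl.levelTime_le_iff]
  simp only [SingularControl.ofStoppingTime]
  split_ifs with h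
  · exact iff_of_true hu.2 h
  · exact iff_of_false (not_le.2 hu.1) h

/-- The control takes only the values `0` and `1`, where `x log x` vanishes. -/
theorem SingularControl.entropy_ofStoppingTime {τ : Ω → WithTop ℝ≥0}
    (hτ : IsStoppingTime 𝔽 τ) (ρ : ℝ) (ω : Ω) :
    (SingularControl.ofStoppingTime hτ).entropy ρ ω = 0 := by
  refine integral_eq_zero_of_ae (Eventually.of_forall fun t => ?_)
  simp only [SingularControl.ofStoppingTime]
  split_ifs <;> simp

/-- Almost surely, the path of `X` is dominated, with an integrable constant. -/
structure IsDominated (D : Data n m) (P : Measure Ω)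
    (X : ℝ≥0 → Ω → EuclideanSpace ℝ (Fin n)) (Z : Ω → ℝ) (c : ℝ) : Prop where
  rho_pos : 0 < D.ρ
  continuous_π : Continuous D.π
  continuous_G : Continuous D.G
  measurable : ∀ t, Measurable (X t)
  integrable : Integrable Z P
  dominated : ∀ᵐ ω ∂P, DominatedPath D (X · ω) (Z ω) c

namespace IsDominated

variable {D : Data n m} {X : ℝ≥0 → Ω → EuclideanSpace ℝ (Fin n)}
  {Z : Ω → ℝ} {c : ℝ}

theorem integrable_pathPayoff (h : IsDominated D P X Z c) {α : Type*} {mα : MeasurableSpace α}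
    {μ : Measure α} {w : α → Ω} (hw : Measurable w) (hq : Measure.QuasiMeasurePreserving w μ P)
    (hZ : Integrable (fun a => Z (w a)) μ) {T : α → WithTop ℝ≥0} (hT : Measurable T) :
    Integrable (fun a => pathPayoff D (X · (w a)) (T a)) μ := by
  obtain ⟨X', hX'm, hX'c, hXX'⟩ := exists_continuous_version h.measurable
    (h.dominated.mono fun ω hω => hω.continuous)
  have hm := measurable_pathPayoff h.continuous_π h.continuous_G
    (measurable_uncurry_of_continuous_of_measurable hX'c hX'm) hw hT
  have hme : AEStronglyMeasurable (fun a => pathPayoff D (X · (w a)) (T a)) μ := by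
    refine hm.aestronglyMeasurable.congr ?_
    filter_upwards [hq.ae hXX'] with a ha
    simp_rw [ha]
  refine Integrable.mono' (hZ.const_mul (c⁻¹ + 1)) hme ?_
  filter_upwards [hq.ae h.dominated] with a ha
  exact ha.abs_pathPayoff_le _

theorem measurable_stoppingTime {τ : Ω → WithTop ℝ≥0} (hτ : IsStoppingTime 𝔽 τ) : Measurable τ :=
  SingularControl.measurable_of_le_coe fun t => 𝔽.le t _ (hτ t)

theorem abs_stopJ_le (h : IsDominated D P X Z c) (τ : Ω → WithTop ℝ≥0) :
    |stopJ D P X τ| ≤ (c⁻¹ + 1) * ∫ ω, Z ω ∂P := by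
  rw [← integral_const_mul, ← Real.norm_eq_abs]
  refine norm_integral_le_of_norm_le (h.integrable.const_mul _) ?_
  filter_upwards [h.dominated] with ω hω
  exact hω.abs_pathPayoff_le _

theorem controlPayoff_ae_eq (h : IsDominated D P X Z c) (ξ : SingularControl 𝔽) (lam : ℝ) :
    controlPayoff D X lam ξ =ᵐ[P] fun ω =>
      (∫ u in Set.Ioc (0 : ℝ) 1, pathPayoff D (X · ω) (ξ.levelTime u ω)) -
        lam * ξ.entropy D.ρ ω := by
  filter_upwards [h.dominated] with ω hω
  exact ξ.controlPayoff_eq hω lam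

theorem integrable_stopPayoff (h : IsDominated D P X Z c) {τ : Ω → WithTop ℝ≥0}
    (hτ : IsStoppingTime 𝔽 τ) : Integrable (stopPayoff D X τ) P :=
  h.integrable_pathPayoff measurable_id (Measure.QuasiMeasurePreserving.id P) h.integrable
    (measurable_stoppingTime hτ)

theorem bddAbove_stopJ (h : IsDominated D P X Z c) :
    BddAbove (Set.range fun τ : {τ : Ω → WithTop ℝ≥0 // IsStoppingTime 𝔽 τ} =>
      stopJ D P X τ.1) :=
  ⟨_, by rintro _ ⟨τ, rfl⟩; exact (abs_le.1 (h.abs_stopJ_le τ.1)).2⟩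

theorem integrable_prod (h : IsDominated D P X Z c) (ξ : SingularControl 𝔽) :
    Integrable (fun p : Ω × ℝ => pathPayoff D (X · p.1) (ξ.levelTime p.2 p.1))
      (P.prod (volume.restrict (Set.Ioc (0 : ℝ) 1))) :=
  h.integrable_pathPayoff measurable_fst Measure.quasiMeasurePreserving_fst
    (h.integrable.comp_fst _) ξ.measurable_levelTime

variable [IsProbabilityMeasure P]

theorem integrable_entropy (h : IsDominated D P X Z c) (ξ : SingularControl 𝔽) :
    Integrable (ξ.entropy D.ρ) P :=
  Integrable.mono' (integrable_const (D.ρ * Real.exp 1)⁻¹)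
    (ξ.measurable_entropy D.ρ).aestronglyMeasurable
    (Eventually.of_forall fun ω => ξ.abs_entropy_le h.rho_pos ω)

theorem integrable_controlPayoff (h : IsDominated D P X Z c) (ξ : SingularControl 𝔽)
    (lam : ℝ) : Integrable (controlPayoff D X lam ξ) P :=
  ((h.integrable_prod ξ).integral_prod_left.sub ((h.integrable_entropy ξ).const_mul lam)).congr
    (h.controlPayoff_ae_eq ξ lam).symm

/-- Fubini over `Ω` and the levels. The right side displays the two facts used below: an average of
stopping functionals, and affine dependence on `lam`. -/
theorem controlJ_eq (h : IsDominated D P X Z c) (ξ : SingularControl 𝔽) (lam : ℝ) :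
    controlJ D P X lam ξ = (∫ u in Set.Ioc (0 : ℝ) 1, stopJ D P X (ξ.levelTime u)) -
      lam * ∫ ω, ξ.entropy D.ρ ω ∂P := by
  rw [controlJ, integral_congr_ae (h.controlPayoff_ae_eq ξ lam),
    integral_sub (h.integrable_prod ξ).integral_prod_left ((h.integrable_entropy ξ).const_mul lam),
    integral_const_mul, integral_integral_swap (h.integrable_prod ξ)]
  rfl

theorem abs_integral_entropy_le (h : IsDominated D P X Z c) (ξ : SingularControl 𝔽) :
    |∫ ω, ξ.entropy D.ρ ω ∂P| ≤ (D.ρ * Real.exp 1)⁻¹ := by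
  have := norm_integral_le_of_norm_le (μ := P) (f := ξ.entropy D.ρ)
    (integrable_const (D.ρ * Real.exp 1)⁻¹)
    (Eventually.of_forall fun ω => ξ.abs_entropy_le h.rho_pos ω)
  simpa using this

theorem integral_stopJ_le (h : IsDominated D P X Z c) (ξ : SingularControl 𝔽) {M : ℝ}
    (hM : ∀ τ, IsStoppingTime 𝔽 τ → stopJ D P X τ ≤ M) :
    ∫ u in Set.Ioc (0 : ℝ) 1, stopJ D P X (ξ.levelTime u) ≤ M := by
  have hi : Integrable (fun u => stopJ D P X (ξ.levelTime u))
      (volume.restrict (Set.Ioc (0 : ℝ) 1)) := (h.integrable_prod ξ).integral_prod_right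
  calc ∫ u in Set.Ioc (0 : ℝ) 1, stopJ D P X (ξ.levelTime u)
      ≤ ∫ _ in Set.Ioc (0 : ℝ) 1, M :=
        integral_mono hi (integrable_const M) fun u => hM _ (ξ.isStoppingTime_levelTime u)
    _ = M := by simp

theorem bddAbove_controlJ (h : IsDominated D P X Z c) (lam : ℝ) :
    BddAbove (Set.range fun ξ : SingularControl 𝔽 => controlJ D P X lam ξ) := by
  refine ⟨(c⁻¹ + 1) * (∫ ω, Z ω ∂P) + |lam| * (D.ρ * Real.exp 1)⁻¹, ?_⟩
  rintro _ ⟨ξ, rfl⟩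
  dsimp only
  rw [h.controlJ_eq, sub_eq_add_neg]
  refine add_le_add (h.integral_stopJ_le ξ fun τ _ => (abs_le.1 (h.abs_stopJ_le τ)).2) ?_
  refine (neg_le_abs _).trans ?_
  rw [abs_mul]
  gcongr
  exact h.abs_integral_entropy_le ξ

theorem wellPosed (h : IsDominated D P X Z c) : WellPosed D P 𝔽 X where
  running := h.dominated.mono fun _ hω => hω.integrableOn_running
  terminal ξ := h.dominated.mono fun ω hω => hω.integrableOn_terminal (ξ.dmeasure ω)
  stopping _ hτ := h.integrable_stopPayoff hτ
  control lam _ ξ := h.integrable_controlPayoff ξ lam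
  stopping_bdd := h.bddAbove_stopJ
  control_bdd lam _ := h.bddAbove_controlJ lam

/-- All level times with `u` in `(0,1]` coincide with `τ`, so the average is constant and the
entropy is zero. -/
theorem controlJ_ofStoppingTime (h : IsDominated D P X Z c) {τ : Ω → WithTop ℝ≥0}
    (hτ : IsStoppingTime 𝔽 τ) (lam : ℝ) :
    controlJ D P X lam (SingularControl.ofStoppingTime hτ) = stopJ D P X τ := by
  rw [h.controlJ_eq]
  simp_rw [SingularControl.entropy_ofStoppingTime]
  have : ∫ u in Set.Ioc (0 : ℝ) 1,
      stopJ D P X ((SingularControl.ofStoppingTime hτ).levelTime u) =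
      ∫ _ in Set.Ioc (0 : ℝ) 1, stopJ D P X τ := by
    refine setIntegral_congr_fun measurableSet_Ioc fun u hu => ?_
    refine congrArg (stopJ D P X) ?_
    exact funext fun ω => SingularControl.levelTime_ofStoppingTime hτ hu ω
  rw [this]
  simp

theorem nonempty_stoppingTime : Nonempty {τ : Ω → WithTop ℝ≥0 // IsStoppingTime 𝔽 τ} :=
  ⟨⟨fun _ => ((0 : ℝ≥0) : WithTop ℝ≥0), isStoppingTime_const 𝔽 0⟩⟩

theorem nonempty_singularControl : Nonempty (SingularControl 𝔽) :=
  ⟨SingularControl.ofStoppingTime (nonempty_stoppingTime (𝔽 := 𝔽)).some.2⟩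

/-- Without entropy, relaxing stopping times to singular controls does not change the value. -/
theorem controlValue_zero (h : IsDominated D P X Z c) :
    controlValue D P 𝔽 X 0 = stopValue D P 𝔽 X := by
  have := nonempty_stoppingTime (𝔽 := 𝔽)
  have := nonempty_singularControl (𝔽 := 𝔽)
  refine le_antisymm (ciSup_le fun ξ => ?_) (ciSup_le fun τ => ?_)
  · rw [h.controlJ_eq, zero_mul, sub_zero]
    exact h.integral_stopJ_le ξ fun τ hτ => le_ciSup (h.bddAbove_stopJ (𝔽 := 𝔽)) ⟨τ, hτ⟩
  · rw [← h.controlJ_ofStoppingTime τ.2 0]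
    exact le_ciSup (h.bddAbove_controlJ 0) _

theorem controlValue_le (h : IsDominated D P X Z c) (lam lam' : ℝ) :
    controlValue D P 𝔽 X lam ≤
      controlValue D P 𝔽 X lam' + |lam - lam'| * (D.ρ * Real.exp 1)⁻¹ := by
  have := nonempty_singularControl (𝔽 := 𝔽)
  refine ciSup_le fun ξ => ?_
  have h1 : controlJ D P X lam' ξ ≤ controlValue D P 𝔽 X lam' :=
    le_ciSup (h.bddAbove_controlJ lam') ξ
  have h2 : controlJ D P X lam ξ - controlJ D P X lam' ξ =
      -((lam - lam') * ∫ ω, ξ.entropy D.ρ ω ∂P) := by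
    rw [h.controlJ_eq, h.controlJ_eq]; ring
  have h3 : -((lam - lam') * ∫ ω, ξ.entropy D.ρ ω ∂P) ≤ |lam - lam'| * (D.ρ * Real.exp 1)⁻¹ := by
    refine (neg_le_abs _).trans ?_
    rw [abs_mul]
    gcongr
    exact h.abs_integral_entropy_le ξ
  linarith

theorem abs_controlValue_sub_le (h : IsDominated D P X Z c) (lam lam' : ℝ) :
    |controlValue D P 𝔽 X lam - controlValue D P 𝔽 X lam'| ≤
      |lam - lam'| * (D.ρ * Real.exp 1)⁻¹ := by
  have h1 := h.controlValue_le (𝔽 := 𝔽) lam lam'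
  have h2 := h.controlValue_le (𝔽 := 𝔽) lam' lam
  rw [abs_sub_comm] at h2
  rw [abs_le]
  constructor <;> linarith

end IsDominated

theorem IsSolution.exists_isDominated [IsProbabilityMeasure P] [P.IsComplete] {D : Data n m}
    (hD : D.Standing) {W : Fin m → ℝ≥0 → Ω → ℝ} (hW : IsBrownianMotion W P)
    {x : EuclideanSpace ℝ (Fin n)} {X : ℝ≥0 → Ω → EuclideanSpace ℝ (Fin n)}
    (hX : IsSolution D (brownianFiltration hW) W P x X) :
    ∃ Z c, IsDominated D P X Z c := by
  obtain ⟨Z, r, hZ, hr, hb⟩ := hX.exists_integrable_bound hD hW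
  refine ⟨Z, D.ρ - r, hD.rho_pos, hD.continuous_π, hD.continuous_G,
    fun t => (hX.adapted t).mono ((brownianFiltration hW).le t) le_rfl, hZ, ?_⟩
  filter_upwards [hb, hX.continuous] with ω hω hc
  refine ⟨by linarith, hc, hD.continuous_π, hD.continuous_G, fun t => ?_, fun t => ?_⟩
  · rw [sub_sub_cancel]; exact (hω t).1
  · rw [sub_sub_cancel]; exact (hω t).2

end Values

end EntropyOS

theorem proposition2p3 {n m : ℕ} (D : EntropyOS.Data n m) (hD : D.Standing)
    {Ω : Type*} {mΩ : MeasurableSpace Ω} (P : Measure Ω) [IsProbabilityMeasure P] [P.IsComplete]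
    (W : Fin m → ℝ≥0 → Ω → ℝ) (hW : EntropyOS.IsBrownianMotion W P)
    (X : EuclideanSpace ℝ (Fin n) → ℝ≥0 → Ω → EuclideanSpace ℝ (Fin n))
    (hX : ∀ x, EntropyOS.IsSolution D (EntropyOS.brownianFiltration hW) W P x (X x)) :
    (∀ x, EntropyOS.WellPosed D P (EntropyOS.brownianFiltration hW) (X x)) ∧
    (∀ lam ∈ Set.Icc (0 : ℝ) 1, ∀ lam' ∈ Set.Icc (0 : ℝ) 1, ∀ x,
      |EntropyOS.controlValue D P (EntropyOS.brownianFiltration hW) (X x) lam -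
          EntropyOS.controlValue D P (EntropyOS.brownianFiltration hW) (X x) lam'| ≤
        |lam - lam'| * (D.ρ * Real.exp 1)⁻¹) ∧
    TendstoUniformly
      (fun lam x => EntropyOS.controlValue D P (EntropyOS.brownianFiltration hW) (X x) lam)
      (fun x => EntropyOS.stopValue D P (EntropyOS.brownianFiltration hW) (X x))
      (𝓝[Set.Icc (0 : ℝ) 1] 0) := by
  have H : ∀ x, ∃ Z c, EntropyOS.IsDominated D P (X x) Z c := fun x =>
    (hX x).exists_isDominated hD hW
  choose Z c H using H
  refine ⟨fun x => (H x).wellPosed, fun lam _ lam' _ x => (H x).abs_controlValue_sub_le lam lam',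
    ?_⟩
  rw [Metric.tendstoUniformly_iff]
  intro ε hε
  have hlim : Tendsto (fun lam : ℝ => |0 - lam| * (D.ρ * Real.exp 1)⁻¹) (𝓝[Set.Icc (0 : ℝ) 1] 0)
      (𝓝 0) := by
    have hc : Continuous fun lam : ℝ => |0 - lam| * (D.ρ * Real.exp 1)⁻¹ := by fun_prop
    simpa using (hc.tendsto 0).mono_left nhdsWithin_le_nhds
  filter_upwards [hlim.eventually_lt_const hε] with lam hlam x
  -- `Z` and `c` vary with `x`, but the Lipschitz bound involves neither, so the convergence is
  -- uniform.
  rw [← (H x).controlValue_zero, Real.dist_eq]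
  exact ((H x).abs_controlValue_sub_le 0 lam).trans_lt hlam
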